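/- Let $\mathfrak g$ be a finite-dimensional simple Lie algebra over $\mathbb C$ with a fixed non-degenerate, invariant, symmetric bilinear form, and let $\Omega\in\mathfrak g\otimes\mathfrak g$ be its Casimir tensor, i.e. $\Omega=\sum_i e_i\otimes e^i$ for a basis $(e_i)$ of $\mathfrak g$ and its dual basis $(e^i)$. Let $\mathfrak g[u]=\mathfrak g\otimes\mathbb C[u]$ be the current Lie bialgebra, graded by the degree in $u$, with cobracket $\delta(xu^n)=\sum_{a+b=n-1}[x\otimes 1,\Omega]\,u^a v^b\in(\mathfrak g\otimes\mathfrak g)[u,v]\cong\mathfrak g[u]\otimes\mathfrak g[u]$. A homogeneous quantization of $(\mathfrak g[u],\delta)$ is an $\mathbb N$-graded Hopf algebra $\mathcal H=\bigoplus_{n\ge 0}\mathcal H_n$ over the graded ring $\mathbb C[\hbar]$, $\deg\hbar=1$, which is torsion free over $\mathbb C[\hbar]$ and equipped with an isomorphism of graded Hopf algebras $\mathcal H/\hbar\mathcal H\cong U(\mathfrak g[u])$, such that $\delta(x)=\hbar^{-1}\bigl(\Delta(\tilde x)-\Delta^{21}(\tilde x)\bigr)$ modulo $\hbar\,\mathcal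 H\otimes_{\mathbb C[\hbar]}\mathcal H$ for every $x\in\mathfrak g[u]$ and every $\tilde x\in\mathcal H$ with $\tilde x\equiv x$ modulo $\hbar$. Then $\mathcal H_0\cong U(\mathfrak g[u])_0=U(\mathfrak g)$, so $\mathfrak g$ is viewed inside $\mathcal H_0$ (each $x\in\mathfrak g$ being the unique element of $\mathcal H_0$ that reduces to $x$ modulo $\hbar$), and $\mathfrak g$ acts on $\mathcal H_1$ by commutators. **Theorem 3.3.** Let $\mathcal H$ be a homogeneous quantization of $(\mathfrak g[u],\delta)$. Then there exists a $\mathfrak g$-module homomorphism $\mathcal J:\mathfrak g\to\mathcal H_1$ (with $\mathfrak g$ acting on itself by the adjoint action) such that, for each $x\in\mathfrak g$, $\mathcal J(x)\equiv xu$ modulo $\hbar$ and $$\Delta(\mathcal J(x))=\mathcal J(x)\otimes 1+1\otimes\mathcal J(x)+\frac{\hbar}{2}[x\otimes 1,\Omega].$$ Moreover, if $\mathcal J':\mathfrak g\to\mathcal H_1$ is another such map, then there is $\lambda\in\mathbb C$ such that $\mathcal J(x)-\mathcal J'(x)=\hbar\lambda x$ for all $x\in\mathfrak g$. -/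

import Mathlib

open scoped TensorProduct
open Polynomial

noncomputable section

namespace YangianQuantization

section Enveloping

attribute [local instance 100] LieRing.ofAssociativeRing

variable (L : Type*) [LieRing L] [LieAlgebra ℂ L]

/-- The canonical map `L → U(L)`, as a linear map. -/
def envι : L →ₗ[ℂ] UniversalEnvelopingAlgebra ℂ L :=
  (UniversalEnvelopingAlgebra.ι ℂ : L →ₗ⁅ℂ⁆ UniversalEnvelopingAlgebra ℂ L)

theorem envι_lie (x y : L) : envι L ⁅x, y⁆ = envι L x * envι L y - envι L y * envι L x := by
  change UniversalEnvelopingAlgebra.ι ℂ ⁅x, y⁆ = _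
  rw [LieHom.map_lie, LieRing.of_associative_ring_bracket]; rfl

/-- The coproduct of `U(L)`: the algebra homomorphism with `x ↦ x ⊗ 1 + 1 ⊗ x` on `L`. -/
def envComul : UniversalEnvelopingAlgebra ℂ L →ₐ[ℂ]
    (UniversalEnvelopingAlgebra ℂ L) ⊗[ℂ] (UniversalEnvelopingAlgebra ℂ L) :=
  UniversalEnvelopingAlgebra.lift ℂ
    { (Algebra.TensorProduct.includeLeft (R := ℂ) (S := ℂ)
        (A := UniversalEnvelopingAlgebra ℂ L) (B := UniversalEnvelopingAlgebra ℂ L)).toLinearMap ∘ₗ envι L +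
        (Algebra.TensorProduct.includeRight (R := ℂ)
        (A := UniversalEnvelopingAlgebra ℂ L) (B := UniversalEnvelopingAlgebra ℂ L)).toLinearMap ∘ₗ envι L with
      map_lie' := by
        intro x y
        simp [LieRing.of_associative_ring_bracket, envι_lie, TensorProduct.sub_tmul,
          TensorProduct.tmul_sub, mul_add, add_mul]
        abel }

/-- The counit of `U(L)`: the algebra homomorphism with `x ↦ 0` on `L`. -/
def envCounit : UniversalEnvelopingAlgebra ℂ L →ₐ[ℂ] ℂ :=
  UniversalEnvelopingAlgebra.lift ℂ
    { (0 : L →ₗ[ℂ] ℂ) with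
      map_lie' := by intro x y; simp }

/-- The antipode of `U(L)`: the algebra anti-homomorphism with `x ↦ -x` on `L`. -/
def envAntipode : UniversalEnvelopingAlgebra ℂ L →ₐ[ℂ]
    (UniversalEnvelopingAlgebra ℂ L)ᵐᵒᵖ :=
  UniversalEnvelopingAlgebra.lift ℂ
    { -((MulOpposite.opLinearEquiv ℂ).toLinearMap ∘ₗ envι L) with
      map_lie' := by
        intro x y
        simp [LieRing.of_associative_ring_bracket, envι_lie] }

theorem envComul_ι (x : L) : envComul L (envι L x) = envι L x ⊗ₜ 1 + 1 ⊗ₜ envι L x :=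
  UniversalEnvelopingAlgebra.lift_ι_apply ℂ _ x

theorem envCounit_ι (x : L) : envCounit L (envι L x) = 0 :=
  UniversalEnvelopingAlgebra.lift_ι_apply ℂ _ x

theorem envAntipode_ι (x : L) : envAntipode L (envι L x) = MulOpposite.op (-envι L x) :=
  UniversalEnvelopingAlgebra.lift_ι_apply ℂ _ x

end Enveloping

section Classical

variable (𝔤 : Type*) [LieRing 𝔤] [LieAlgebra ℂ 𝔤]

/-- The polynomial current algebra `𝔤[u] = ℂ[u] ⊗ 𝔤`, with bracket
`[p ⊗ x, q ⊗ y] = pq ⊗ [x, y]`; the element `x uⁿ` is `X ^ n ⊗ₜ x`. -/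
abbrev Current := ℂ[X] ⊗[ℂ] 𝔤

/-- The enveloping algebra `U(𝔤[u])`. -/
abbrev EnvCurrent := UniversalEnvelopingAlgebra ℂ (Current 𝔤)

variable {𝔤}

/-- The element `x uⁿ` of `U(𝔤[u])`. -/
def envMonomial (n : ℕ) (x : 𝔤) : EnvCurrent 𝔤 :=
  envι (Current 𝔤) ((X ^ n : ℂ[X]) ⊗ₜ[ℂ] x : Current 𝔤)

variable (𝔤) in
/-- The `n`-th homogeneous component of `U(𝔤[u])`: the span of the products
`(x₁ u^{n₁}) ⋯ (x_k u^{n_k})` with `n₁ + ⋯ + n_k = n`. -/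
def envGrading (n : ℕ) : Submodule ℂ (EnvCurrent 𝔤) :=
  Submodule.span ℂ {y | ∃ l : List (ℕ × 𝔤),
    (l.map Prod.fst).sum = n ∧ y = (l.map fun p => envMonomial p.1 p.2).prod}

/-- The Casimir tensor `Ω ∈ 𝔤 ⊗ 𝔤` of a nondegenerate form `B`, that is `∑ eᵢ ⊗ eⁱ` for any
basis `(eᵢ)` of `𝔤` and its dual basis `(eⁱ)` with respect to `B`. -/
def casimir [FiniteDimensional ℂ 𝔤] (B : LinearMap.BilinForm ℂ 𝔤) (hB : B.Nondegenerate) :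
    𝔤 ⊗[ℂ] 𝔤 :=
  ((B.toDual hB).symm.toLinearMap.lTensor 𝔤) (coevaluation ℂ 𝔤 1)

/-- The linear map `x ↦ [x ⊗ 1, t]` for a tensor `t ∈ 𝔤 ⊗ 𝔤`, where
`[x ⊗ 1, y ⊗ z] = [x, y] ⊗ z`. -/
def bracketLeft (t : 𝔤 ⊗[ℂ] 𝔤) : 𝔤 →ₗ[ℂ] 𝔤 ⊗[ℂ] 𝔤 where
  toFun x := (LieAlgebra.ad ℂ 𝔤 x : 𝔤 →ₗ[ℂ] 𝔤).rTensor 𝔤 t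
  map_add' x y := by simp [LinearMap.rTensor_add]
  map_smul' c x := by simp [LinearMap.rTensor_smul]

/-- The linear map `ℂ[u] → ℂ[u] ⊗ ℂ[u]` given by `uⁿ ↦ ∑_{a + b = n - 1} uᵃ ⊗ uᵇ`. -/
def divDiff : ℂ[X] →ₗ[ℂ] ℂ[X] ⊗[ℂ] ℂ[X] :=
  (Polynomial.basisMonomials ℂ).constr ℂ fun n =>
    ∑ a ∈ Finset.range n, (X ^ a : ℂ[X]) ⊗ₜ[ℂ] (X ^ (n - 1 - a) : ℂ[X])

/-- The cobracket `δ : 𝔤[u] → 𝔤[u] ⊗ 𝔤[u]`, `δ(x uⁿ) = ∑_{a + b = n - 1} [x ⊗ 1, Ω] uᵃ vᵇ`. -/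
def cobracket [FiniteDimensional ℂ 𝔤] (B : LinearMap.BilinForm ℂ 𝔤) (hB : B.Nondegenerate) :
    Current 𝔤 →ₗ[ℂ] Current 𝔤 ⊗[ℂ] Current 𝔤 :=
  (TensorProduct.tensorTensorTensorComm ℂ ℂ[X] ℂ[X] 𝔤 𝔤).toLinearMap ∘ₗ
    TensorProduct.map divDiff (bracketLeft (casimir B hB))

end Classical

section Quantization

variable {H : Type*} [Ring H] [Algebra ℂ H] [HopfAlgebra ℂ[X] H] [IsScalarTower ℂ ℂ[X] H]

theorem smul_tmul_aux (c : ℂ) (a b : H) :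
    (c • a) ⊗ₜ[ℂ[X]] b = a ⊗ₜ[ℂ[X]] (c • b) := by
  rw [← algebraMap_smul ℂ[X] c a, ← algebraMap_smul ℂ[X] c b, TensorProduct.smul_tmul]

variable (H) in
/-- The canonical map `H ⊗_ℂ H → H ⊗_{ℂ[ħ]} H`, `a ⊗ b ↦ a ⊗ b`. -/
def toTensor : H ⊗[ℂ] H →ₗ[ℂ] H ⊗[ℂ[X]] H :=
  TensorProduct.lift
    { toFun := fun a =>
        { toFun := fun b => a ⊗ₜ[ℂ[X]] b
          map_add' := fun b c => TensorProduct.tmul_add a b c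
          map_smul' := fun c b => (smul_tmul_aux c a b).symm }
      map_add' := fun a b => LinearMap.ext fun c => TensorProduct.add_tmul a b c
      map_smul' := fun _ _ => LinearMap.ext fun _ => rfl }

/-- The total grading on `H ⊗_{ℂ[ħ]} H` induced by a family of subspaces of `H`: the degree `n`
part is spanned by the `a ⊗ b` with `a` of degree `i`, `b` of degree `j` and `i + j = n`. -/
def tensorGrading (𝓗 : ℕ → Submodule ℂ H) (n : ℕ) : Submodule ℂ (H ⊗[ℂ[X]] H) :=
  Submodule.span ℂ {t | ∃ i j : ℕ, i + j = n ∧ ∃ a ∈ 𝓗 i, ∃ b ∈ 𝓗 j, t = a ⊗ₜ[ℂ[X]] b}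

/-- The family `𝓗` of complex subspaces makes `H` an `ℕ`-graded Hopf algebra over the graded ring
`ℂ[ħ]`, where `ħ = X` has degree one. -/
structure IsGradedHopf (𝓗 : ℕ → Submodule ℂ H) : Prop where
  isInternal : DirectSum.IsInternal 𝓗
  one_mem : (1 : H) ∈ 𝓗 0
  mul_mem : ∀ m n : ℕ, ∀ a ∈ 𝓗 m, ∀ b ∈ 𝓗 n, a * b ∈ 𝓗 (m + n)
  hbar_smul_mem : ∀ n : ℕ, ∀ a ∈ 𝓗 n, (X : ℂ[X]) • a ∈ 𝓗 (n + 1)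
  comul_mem : ∀ n : ℕ, ∀ a ∈ 𝓗 n, Coalgebra.comul (R := ℂ[X]) a ∈ tensorGrading 𝓗 n
  counit_mem : ∀ n : ℕ, ∀ a ∈ 𝓗 n, ∃ c : ℂ, Coalgebra.counit (R := ℂ[X]) a = C c * X ^ n
  antipode_mem : ∀ n : ℕ, ∀ a ∈ 𝓗 n, HopfAlgebra.antipode ℂ[X] a ∈ 𝓗 n

/-- The map `H ⊗_{ℂ[ħ]} H → A ⊗_ℂ A` induced by an algebra homomorphism `π : H → A` that sends
`ħ H` to zero. -/
def specializeTensor {A : Type*} [Ring A] [Algebra ℂ A] (π : H →ₐ[ℂ] A)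
    (hπ : ∀ h : H, π ((X : ℂ[X]) • h) = 0) : H ⊗[ℂ[X]] H →+ A ⊗[ℂ] A :=
  TensorProduct.liftAddHom
    { toFun := fun a =>
        { toFun := fun b => π a ⊗ₜ[ℂ] π b
          map_zero' := by simp
          map_add' := fun b c => by simp [TensorProduct.tmul_add] }
      map_zero' := by ext; simp
      map_add' := fun a b => by ext; simp [TensorProduct.add_tmul] }
    (by
      have key : ∀ (p : ℂ[X]) (h : H), π (p • h) = p.coeff 0 • π h := by
        intro p h
        conv_lhs => rw [← Polynomial.divX_mul_X_add p]
        have hC : (C (p.coeff 0) : ℂ[X]) • h = p.coeff 0 • h := by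
          rw [← Polynomial.algebraMap_eq, algebraMap_smul]
        rw [add_smul, mul_comm, mul_smul, map_add, hπ, zero_add, hC, map_smul]
      intro p a b
      simp [key, TensorProduct.smul_tmul])

theorem specializeTensor_tmul {A : Type*} [Ring A] [Algebra ℂ A] (π : H →ₐ[ℂ] A)
    (hπ : ∀ h : H, π ((X : ℂ[X]) • h) = 0) (a b : H) :
    specializeTensor π hπ (a ⊗ₜ[ℂ[X]] b) = π a ⊗ₜ[ℂ] π b := rfl

variable {𝔤 : Type*} [LieRing 𝔤] [LieAlgebra ℂ 𝔤] [FiniteDimensional ℂ 𝔤]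

variable (H) in
/-- A homogeneous quantization of the Lie bialgebra `(𝔤[u], δ)` on the Hopf algebra `H` over
`ℂ[ħ]`, where `ħ = X`. The isomorphism of graded Hopf algebras `H / ħH ≅ U(𝔤[u])` is given by the
corresponding quotient map `π : H → U(𝔤[u])`, with kernel `ħH`. -/
structure HomogeneousQuantization (B : LinearMap.BilinForm ℂ 𝔤) (hB : B.Nondegenerate) where
  /-- the homogeneous components `H_n` -/
  comp : ℕ → Submodule ℂ H
  isGradedHopf : IsGradedHopf comp
  torsionFree : Module.IsTorsionFree ℂ[X] H
  /-- the quotient map `H → H / ħH ≅ U(𝔤[u])` -/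
  π : H →ₐ[ℂ] EnvCurrent 𝔤
  π_surjective : Function.Surjective π
  π_eq_zero_iff : ∀ h : H, π h = 0 ↔ ∃ h' : H, h = (X : ℂ[X]) • h'
  π_comp : ∀ n : ℕ, (comp n).map π.toLinearMap = envGrading 𝔤 n
  π_comul : ∀ h : H,
    specializeTensor π (fun h' => (π_eq_zero_iff _).2 ⟨h', rfl⟩) (Coalgebra.comul (R := ℂ[X]) h) =
      envComul (Current 𝔤) (π h)
  π_counit : ∀ h : H,
    (Coalgebra.counit (R := ℂ[X]) h).eval 0 = envCounit (Current 𝔤) (π h)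
  π_antipode : ∀ h : H,
    π (HopfAlgebra.antipode ℂ[X] h) = (envAntipode (Current 𝔤) (π h)).unop
  /-- `δ(x) = (Δ(x̃) - Δ²¹(x̃)) / ħ` modulo `ħ`, for every `x̃` that reduces to `x` modulo `ħ` -/
  comul_sub_comul_op : ∀ (x : Current 𝔤) (x' : H), π x' = envι (Current 𝔤) x →
    ∃ t : H ⊗[ℂ[X]] H,
      Coalgebra.comul (R := ℂ[X]) x' -
          TensorProduct.comm ℂ[X] H H (Coalgebra.comul (R := ℂ[X]) x') = (X : ℂ[X]) • t ∧
        specializeTensor π (fun h' => (π_eq_zero_iff _).2 ⟨h', rfl⟩) t =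
          TensorProduct.map (envι (Current 𝔤)) (envι (Current 𝔤)) (cobracket B hB x)

namespace HomogeneousQuantization

variable {B : LinearMap.BilinForm ℂ 𝔤} {hB : B.Nondegenerate} (Q : HomogeneousQuantization H B hB)

theorem eq_zero_of_mem_zero (h : H) (hh : h ∈ Q.comp 0) (hπ : Q.π h = 0) : h = 0 := by
  classical
  obtain ⟨h', rfl⟩ := (Q.π_eq_zero_iff h).1 hπ
  let _ : DirectSum.Decomposition Q.comp := Q.isGradedHopf.isInternal.chooseDecomposition
  have key : ∀ y : H, (DirectSum.decompose Q.comp ((X : ℂ[X]) • y) 0 : H) = 0 := by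
    intro y
    induction y using DirectSum.Decomposition.inductionOn Q.comp with
    | zero => simp
    | homogeneous m =>
      rename_i i
      exact DirectSum.decompose_of_mem_ne Q.comp
        (Q.isGradedHopf.hbar_smul_mem i m m.2) (Nat.succ_ne_zero i)
    | add m m' h1 h2 => rw [smul_add, DirectSum.decompose_add]; simp [h1, h2]
  rw [← DirectSum.decompose_of_mem_same Q.comp hh]
  exact key h'

theorem existsUnique_lift (x : 𝔤) : ∃! h : H, h ∈ Q.comp 0 ∧ Q.π h = envMonomial 0 x := by
  have hx : envMonomial 0 x ∈ envGrading 𝔤 0 :=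
    Submodule.subset_span ⟨[(0, x)], by simp, by simp⟩
  rw [← Q.π_comp 0] at hx
  obtain ⟨h, hh, e⟩ := hx
  refine ⟨h, ⟨hh, e⟩, fun h' hh' => ?_⟩
  refine sub_eq_zero.1 (Q.eq_zero_of_mem_zero _ (sub_mem hh'.1 hh) ?_)
  rw [map_sub, hh'.2, sub_eq_zero]
  exact e.symm

/-- The embedding `𝔤 ⊆ U(𝔤) ≅ H₀ ⊆ H`: an element `x ∈ 𝔤` is identified with the unique element
of `H` of degree zero that reduces to `x` modulo `ħ`. -/
def incl : 𝔤 →ₗ[ℂ] H where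
  toFun x := (Q.existsUnique_lift x).choose
  map_add' x y := by
    refine ((Q.existsUnique_lift (x + y)).choose_spec.2 _ ?_).symm
    have hx := (Q.existsUnique_lift x).choose_spec.1
    have hy := (Q.existsUnique_lift y).choose_spec.1
    refine ⟨add_mem hx.1 hy.1, ?_⟩
    rw [map_add, hx.2, hy.2]
    simp only [envMonomial, TensorProduct.tmul_add, map_add]
  map_smul' c x := by
    refine ((Q.existsUnique_lift (c • x)).choose_spec.2 _ ?_).symm
    have hx := (Q.existsUnique_lift x).choose_spec.1
    refine ⟨Submodule.smul_mem _ c hx.1, ?_⟩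
    rw [RingHom.id_apply, map_smul, hx.2]
    simp only [envMonomial, TensorProduct.tmul_smul, map_smul]

theorem incl_mem (x : 𝔤) : Q.incl x ∈ Q.comp 0 := (Q.existsUnique_lift x).choose_spec.1.1

theorem π_incl (x : 𝔤) : Q.π (Q.incl x) = envMonomial 0 x :=
  (Q.existsUnique_lift x).choose_spec.1.2

/-- The Casimir tensor `Ω ∈ 𝔤 ⊗ 𝔤`, viewed in `H ⊗_{ℂ[ħ]} H`. -/
def Ω : H ⊗[ℂ[X]] H := toTensor H (TensorProduct.map Q.incl Q.incl (casimir B hB))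

/-- `J : 𝔤 → H₁` is a `𝔤`-module homomorphism (for the adjoint actions) with `J(x) = x u` modulo
`ħ` and `Δ(J(x)) = J(x) ⊗ 1 + 1 ⊗ J(x) + (ħ / 2) [x ⊗ 1, Ω]`. -/
structure IsDegreeOneLift (J : 𝔤 →ₗ[ℂ] Q.comp 1) : Prop where
  map_lie : ∀ x y : 𝔤, (J ⁅x, y⁆ : H) = Q.incl x * (J y : H) - (J y : H) * Q.incl x
  π_apply : ∀ x : 𝔤, Q.π (J x) = envMonomial 1 x
  comul_apply : ∀ x : 𝔤, Coalgebra.comul (R := ℂ[X]) (J x : H) =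
    (J x : H) ⊗ₜ[ℂ[X]] (1 : H) + (1 : H) ⊗ₜ[ℂ[X]] (J x : H) +
      (C (1 / 2) * X : ℂ[X]) •
        ((Q.incl x ⊗ₜ[ℂ[X]] (1 : H)) * Q.Ω - Q.Ω * (Q.incl x ⊗ₜ[ℂ[X]] (1 : H)))

end HomogeneousQuantization

end Quantization

end YangianQuantization

end

/-! Take any `h` in H₁ reducing to xu. Its failure to be primitive vanishes modulo ħ and has degree
one, so it equals ħs with s in U(𝔤) ⊗ U(𝔤), because H₀ is a copy of U(𝔤). Coassociativity, divided
by ħ (torsion-freeness) and reduced, makes s a 2-cocycle of the cobar complex of U(𝔤), and the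
quantization condition says s - s²¹ = [x ⊗ 1, Ω]. Since [x ⊗ 1, Ω] is itself an antisymmetric
cocycle, s - ½[x ⊗ 1, Ω] is a symmetric one, hence a coboundary dw (`exists_eq_cobarOne`), and h -
ħw has the required coproduct (`exists_lift`).

Two such lifts of the same xu differ by ħ times a primitive element of U(𝔤), that is, by an element
of ħ𝔤 (`exists_ι_of_primitive`, `exists_eq_hbar_smul_incl`). Hence, for a linear choice j of lifts,
the defect [x, j(y)] - j([x, y]) is ħ f(x)(y) for a 1-cocycle f : 𝔤 → End 𝔤. Whitehead's lemma
(`exists_eq_lie`) writes f as the coboundary of some φ, and j - ħφ is equivariant. Two equivariant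
solutions differ by ħ times an endomorphism of the adjoint representation, a scalar by Schur
(`exists_eq_smul_of_map_lie`).

The two facts about U(𝔤) are obtained without the PBW theorem, from the Adams operation ψ = m ∘ Δ.
It acts as 2ⁿ in degree n of the associated graded algebra, whereas it doubles primitive elements,
and ψ ⊗ ψ doubles symmetric cocycles up to coboundaries (`map_adams_sub_eq_cobarOne`). Comparing
eigenvalues pushes both problems down the filtration to degree one. -/

noncomputable section

namespace YangianQuantization

/-! ### Invariance and symmetry of the Casimir tensor. -/

section Casimir

variable {𝔤 : Type*} [LieRing 𝔤] [LieAlgebra ℂ 𝔤]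

/-- The contraction `a ⊗ b ↦ (y ↦ B(b, y) a)` of a tensor with a bilinear form. -/
def contraction (B : LinearMap.BilinForm ℂ 𝔤) : 𝔤 ⊗[ℂ] 𝔤 →ₗ[ℂ] 𝔤 →ₗ[ℂ] 𝔤 :=
  dualTensorHom ℂ 𝔤 𝔤 ∘ₗ (TensorProduct.comm ℂ 𝔤 (Module.Dual ℂ 𝔤)).toLinearMap ∘ₗ
    LinearMap.lTensor 𝔤 B

@[simp]
theorem contraction_tmul (B : LinearMap.BilinForm ℂ 𝔤) (a b y : 𝔤) :
    contraction B (a ⊗ₜ b) y = B b y • a := by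
  simp [contraction]

variable {B : LinearMap.BilinForm ℂ 𝔤}

theorem contraction_lie (hinv : B.lieInvariant 𝔤) (x : 𝔤) (t : 𝔤 ⊗[ℂ] 𝔤) (y : 𝔤) :
    contraction B ⁅x, t⁆ y = ⁅x, contraction B t y⁆ - contraction B t ⁅x, y⁆ := by
  induction t using TensorProduct.induction_on with
  | zero => simp
  | tmul a b =>
    simp [TensorProduct.LieModule.lie_tmul_right, hinv x b y, sub_eq_add_neg]
  | add s t hs ht =>
    rw [lie_add, map_add, LinearMap.add_apply, hs, ht]
    simp only [map_add, LinearMap.add_apply, lie_add]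
    abel

variable [FiniteDimensional ℂ 𝔤]

/-- Nondegeneracy turns the contraction into the canonical isomorphism 𝔤 ⊗ 𝔤* ≅ End 𝔤. Identities
between tensors can therefore be checked on endomorphisms, where Ω is the identity. -/
theorem contraction_injective (hB : B.Nondegenerate) : Function.Injective (contraction B) := by
  have h : (contraction B : 𝔤 ⊗[ℂ] 𝔤 →ₗ[ℂ] 𝔤 →ₗ[ℂ] 𝔤) =
      ((LinearEquiv.lTensor 𝔤 (B.toDual hB)) ≪≫ₗ TensorProduct.comm ℂ 𝔤 (Module.Dual ℂ 𝔤) ≪≫ₗ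
        dualTensorHomEquiv ℂ 𝔤 𝔤).toLinearMap := by
    ext a b y
    simp [contraction, LinearMap.BilinForm.toDual_def]
  rw [h]
  exact LinearEquiv.injective _

theorem contraction_casimir (hB : B.Nondegenerate) :
    contraction B (casimir B hB) = LinearMap.id := by
  ext y
  rw [casimir, coevaluation_apply_one]
  simp only [map_sum, LinearMap.lTensor_tmul, LinearMap.sum_apply]
  simp only [contraction_tmul, LinearEquiv.coe_coe, LinearMap.BilinForm.apply_toDual_symm_apply,
    LinearMap.id_apply]
  exact (Module.Basis.ofVectorSpace ℂ 𝔤).sum_repr y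

/-- For an invariant form the contraction is equivariant, and the identity commutes with ad x. -/
theorem lie_casimir (hB : B.Nondegenerate) (hinv : B.lieInvariant 𝔤) (x : 𝔤) :
    ⁅x, casimir B hB⁆ = 0 := by
  apply contraction_injective hB
  ext y
  rw [contraction_lie hinv, contraction_casimir]
  simp

theorem comm_casimir (hB : B.Nondegenerate) (hsymm : B.IsSymm) :
    TensorProduct.comm ℂ 𝔤 𝔤 (casimir B hB) = casimir B hB := by
  apply contraction_injective hB
  rw [contraction_casimir]
  -- Flipping a tensor replaces its endomorphism by the adjoint with respect to `B`; the identity is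
  -- self-adjoint once `B` is symmetric.
  have key : ∀ (t : 𝔤 ⊗[ℂ] 𝔤) (y z : 𝔤),
      B (contraction B (TensorProduct.comm ℂ 𝔤 𝔤 t) y) z = B (contraction B t z) y := by
    intro t y z
    induction t using TensorProduct.induction_on with
    | zero => simp
    | tmul a b => simp [mul_comm]
    | add s t hs ht => simp [hs, ht]
  ext y
  refine sub_eq_zero.1 (hB.1 _ fun z => ?_)
  rw [map_sub, LinearMap.sub_apply, key, contraction_casimir]
  simpa [sub_eq_zero] using! hsymm.eq z y

end Casimir

/-! ### Whitehead's first lemma and Schur's lemma. -/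

section Whitehead

variable {L : Type*} [LieRing L] [LieAlgebra ℂ L]
variable {M : Type*} [AddCommGroup M] [Module ℂ M] [LieRingModule L M] [LieModule ℂ L M]

/-- The endomorphism `m ↦ ∑ a (b m)` of a Lie module attached to a tensor `∑ a ⊗ b`. -/
def tensorAction : L ⊗[ℂ] L →ₗ[ℂ] Module.End ℂ M :=
  TensorProduct.lift ((LinearMap.mul ℂ (Module.End ℂ M)).compl₁₂
    (LieModule.toEnd ℂ L M : L →ₗ[ℂ] Module.End ℂ M)
    (LieModule.toEnd ℂ L M : L →ₗ[ℂ] Module.End ℂ M))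

theorem tensorAction_tmul (a b : L) (m : M) :
    tensorAction (a ⊗ₜ[ℂ] b) m = ⁅a, ⁅b, m⁆⁆ := by
  simp [tensorAction]

theorem lie_tensorAction (x : L) (t : L ⊗[ℂ] L) (m : M) :
    ⁅x, tensorAction t m⁆ = tensorAction ⁅x, t⁆ m + tensorAction t ⁅x, m⁆ := by
  induction t using TensorProduct.induction_on with
  | zero => simp
  | tmul a b =>
    simp only [TensorProduct.LieModule.lie_tmul_right, map_add, LinearMap.add_apply,
      tensorAction_tmul]
    rw [leibniz_lie x a, leibniz_lie x b, lie_add, add_assoc]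
  | add s t hs ht =>
    simp only [map_add, LinearMap.add_apply, lie_add, hs, ht]
    abel

/-- Used for the Casimir tensor of the trace form of `M`: its contraction is the identity, so the
Casimir operator has trace dim L, in particular is nonzero. -/
theorem trace_tensorAction [FiniteDimensional ℂ L] (t : L ⊗[ℂ] L) :
    LinearMap.trace ℂ M (tensorAction t) =
      LinearMap.trace ℂ L (contraction (LieModule.traceForm ℂ L M) t) := by
  induction t using TensorProduct.induction_on with
  | zero => simp
  | tmul a b =>
    have h : contraction (LieModule.traceForm ℂ L M) (a ⊗ₜ b) =
        dualTensorHom ℂ L L (LieModule.traceForm ℂ L M b ⊗ₜ a) := by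
      ext y; simp
    rw [h, LinearMap.trace_eq_contract_apply, contractLeft_apply, LieModule.traceForm_comm]
    rfl
  | add s t hs ht => simp [hs, ht]

/-- The element `∑ a f(b)` attached to a tensor `∑ a ⊗ b` and a linear map `f : L → M`. -/
def tensorEval (f : L →ₗ[ℂ] M) : L ⊗[ℂ] L →ₗ[ℂ] M :=
  TensorProduct.lift ((LieModule.toEnd ℂ L M : L →ₗ[ℂ] Module.End ℂ M).compl₂ f)

theorem tensorEval_tmul (f : L →ₗ[ℂ] M) (a b : L) : tensorEval f (a ⊗ₜ[ℂ] b) = ⁅a, f b⁆ := by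
  simp [tensorEval]

/-- When `t` is invariant the first term disappears, so ∑ a f(b) is a primitive of the cocycle `f`
followed by the Casimir operator. -/
theorem lie_tensorEval {f : L →ₗ[ℂ] M} (hf : ∀ x y, f ⁅x, y⁆ = ⁅x, f y⁆ - ⁅y, f x⁆) (x : L)
    (t : L ⊗[ℂ] L) : ⁅x, tensorEval f t⁆ = tensorEval f ⁅x, t⁆ + tensorAction t (f x) := by
  induction t using TensorProduct.induction_on with
  | zero => simp
  | tmul a b =>
    simp only [TensorProduct.LieModule.lie_tmul_right, map_add, tensorEval_tmul, tensorAction_tmul]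
    rw [leibniz_lie x a, hf x b, lie_sub]
    abel
  | add s t hs ht =>
    simp only [map_add, LinearMap.add_apply, lie_add, hs, ht]
    abel

variable [LieAlgebra.IsSimple ℂ L]

variable (L) in
theorem derivedSeries_one_eq_top : LieAlgebra.derivedSeries ℂ L 1 = ⊤ := by
  refine (LieAlgebra.IsSimple.eq_bot_or_eq_top (R := ℂ) _).resolve_left fun h => ?_
  refine LieAlgebra.IsSimple.non_abelian ℂ (L := L) ⟨fun x y => ?_⟩
  have : ⁅x, y⁆ ∈ LieAlgebra.derivedSeries ℂ L 1 :=
    LieSubmodule.lie_mem_lie (LieSubmodule.mem_top x) (LieSubmodule.mem_top y)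
  rw [h] at this
  simpa using this

theorem eq_zero_of_isTrivial [LieModule.IsTrivial L M] (f : L →ₗ[ℂ] M)
    (hf : ∀ x y, f ⁅x, y⁆ = ⁅x, f y⁆ - ⁅y, f x⁆) : f = 0 := by
  have h : ∀ x ∈ LieAlgebra.derivedSeries ℂ L 1, f x = 0 := by
    intro x hx
    rw [LieAlgebra.derivedSeries_def, LieAlgebra.derivedSeriesOfIdeal_succ,
      ← LieSubmodule.mem_toSubmodule, LieSubmodule.lieIdeal_oper_eq_linear_span'] at hx
    induction hx using Submodule.span_induction with
    | mem x hx =>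
      obtain ⟨a, -, b, -, rfl⟩ := hx
      simp [hf, LieModule.IsTrivial.trivial]
    | zero => simp
    | add x y _ _ hx hy => simp [hx, hy]
    | smul c x _ hx => simp [hx]
  ext x
  exact h x (derivedSeries_one_eq_top L ▸ LieSubmodule.mem_top x)

variable [FiniteDimensional ℂ M]

variable (L M) in
-- The radical of the trace form is an ideal, so a degenerate trace form on a simple algebra is
-- zero. Then L = [L, L] acts nilpotently, nonzero invariants exist, and by irreducibility they fill
-- `M`.
theorem isTrivial_of_traceForm_not_nondegenerate [LieModule.IsIrreducible ℂ L M]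
    (h : ¬ (LieModule.traceForm ℂ L M).Nondegenerate) : LieModule.IsTrivial L M := by
  have h0 : LieModule.traceForm ℂ L M = 0 := by
    let I : LieIdeal ℂ L := LieAlgebra.InvariantForm.orthogonal (LieModule.traceForm ℂ L M)
      (LieModule.traceForm_lieInvariant ℂ L M) ⊤
    have hI : ∀ y, y ∈ I ↔ ∀ x, LieModule.traceForm ℂ L M x y = 0 := fun y => by
      simp [I, LieAlgebra.InvariantForm.mem_orthogonal]
    rcases LieAlgebra.IsSimple.eq_bot_or_eq_top (R := ℂ) I with hb | ht
    · refine absurd ⟨fun x hx => ?_, fun y hy => ?_⟩ h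
      · rw [← LieSubmodule.mem_bot (R := ℂ) (L := L) x, ← hb, hI]
        intro y
        rw [LieModule.traceForm_comm]
        exact hx y
      · rw [← LieSubmodule.mem_bot (R := ℂ) (L := L) y, ← hb, hI]
        exact hy
    · ext x y
      exact (hI y).1 (ht ▸ LieSubmodule.mem_top y) x
  have hn := LieModule.isNilpotent_derivedSeries_of_traceForm_eq_zero h0
  have : LieModule.IsNilpotent L M := by
    rw [LieModule.isNilpotent_iff_forall' (R := ℂ)] at hn ⊢
    intro x
    exact hn ⟨x, derivedSeries_one_eq_top L ▸ LieSubmodule.mem_top x⟩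
  have := LieModule.nontrivial_of_isIrreducible ℂ L M
  have := LieModule.nontrivial_max_triv_of_isNilpotent ℂ L M
  rw [LieModule.isTrivial_iff_max_triv_eq_top ℂ L M]
  exact LieSubmodule.eq_top_of_isIrreducible ℂ L M _

/-- If the trace form is nondegenerate, its Casimir operator commutes with the action and has
nonzero trace, so it is invertible by irreducibility; `m` is the preimage of ∑ a f(b). Otherwise the
action is trivial and a cocycle kills [L, L] = L. -/
theorem exists_eq_lie_of_isIrreducible [FiniteDimensional ℂ L] [LieModule.IsIrreducible ℂ L M]
    (f : L →ₗ[ℂ] M) (hf : ∀ x y, f ⁅x, y⁆ = ⁅x, f y⁆ - ⁅y, f x⁆) : ∃ m : M, ∀ x, f x = ⁅x, m⁆ := by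
  by_cases h : (LieModule.traceForm ℂ L M).Nondegenerate
  · have hinv := LieModule.traceForm_lieInvariant ℂ L M
    set t := casimir (LieModule.traceForm ℂ L M) h with ht
    have hcomm : ∀ (x : L) (m : M), ⁅x, tensorAction t m⁆ = tensorAction t ⁅x, m⁆ := fun x m => by
      rw [lie_tensorAction, ht, lie_casimir h hinv, map_zero, LinearMap.zero_apply, zero_add]
    let K : LieSubmodule ℂ L M :=
      { LinearMap.ker (tensorAction t : Module.End ℂ M) with
        lie_mem := fun {x m} hm => by
          change tensorAction t ⁅x, m⁆ = 0
          rw [← hcomm, show tensorAction t m = 0 from hm, lie_zero] }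
    have hK : K = ⊥ := by
      refine (eq_bot_or_eq_top K).resolve_right fun hK => ?_
      have h0 : (tensorAction t : Module.End ℂ M) = 0 := by
        ext m
        exact (hK ▸ LieSubmodule.mem_top m : m ∈ K)
      have htr := trace_tensorAction (M := M) t
      rw [h0, map_zero, ht, contraction_casimir, LinearMap.trace_id] at htr
      have := LieAlgebra.IsSimple.nontrivial ℂ L
      exact (Module.finrank_pos (R := ℂ) (M := L)).ne' (by exact_mod_cast htr.symm)
    have hinj : Function.Injective (tensorAction t : Module.End ℂ M) := by
      rw [← LinearMap.ker_eq_bot, eq_bot_iff]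
      intro m hm
      have : m ∈ K := hm
      rw [hK] at this
      simpa using this
    obtain ⟨m, hm⟩ := (LinearMap.injective_iff_surjective.1 hinj) (tensorEval f t)
    refine ⟨m, fun x => hinj ?_⟩
    rw [← hcomm, hm, lie_tensorEval hf, ht, lie_casimir h hinv, map_zero, zero_add]
  · have := isTrivial_of_traceForm_not_nondegenerate L M h
    exact ⟨0, fun x => by simp [eq_zero_of_isTrivial f hf]⟩

end Whitehead

/-- **Whitehead's first lemma** for a simple Lie algebra. -/
theorem exists_eq_lie {L : Type*} [LieRing L] [LieAlgebra ℂ L] [FiniteDimensional ℂ L]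
    [LieAlgebra.IsSimple ℂ L] {M : Type*} [AddCommGroup M] [Module ℂ M] [LieRingModule L M]
    [LieModule ℂ L M] [FiniteDimensional ℂ M] (f : L →ₗ[ℂ] M)
    (hf : ∀ x y, f ⁅x, y⁆ = ⁅x, f y⁆ - ⁅y, f x⁆) : ∃ m : M, ∀ x, f x = ⁅x, m⁆ := by
  induction hn : Module.finrank ℂ M using Nat.strong_induction_on generalizing M with
  | _ n ih =>
  subst hn
  by_cases hirr : LieModule.IsIrreducible ℂ L M
  · exact exists_eq_lie_of_isIrreducible f hf
  rcases subsingleton_or_nontrivial M with hs | hM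
  · exact ⟨0, fun x => Subsingleton.elim _ _⟩
  obtain ⟨N, hN0, hN1⟩ : ∃ N : LieSubmodule ℂ L M, N ≠ ⊥ ∧ N ≠ ⊤ := by
    by_contra! hcon
    exact hirr (LieModule.IsIrreducible.mk hcon)
  have hNlt : Module.finrank ℂ N < Module.finrank ℂ M :=
    Submodule.finrank_lt (by simpa using hN1)
  have hNpos : 0 < Module.finrank ℂ N := by
    have : Nontrivial N := (LieSubmodule.nontrivial_iff_ne_bot ℂ L M).2 hN0
    exact Module.finrank_pos
  have hQ : Module.finrank ℂ (M ⧸ N) < Module.finrank ℂ M := by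
    have := Submodule.finrank_quotient_add_finrank N.toSubmodule
    change Module.finrank ℂ (M ⧸ N) + Module.finrank ℂ N = _ at this
    omega
  -- Solve the equation in M/N first; subtracting the coboundary of a lift of the solution leaves a
  -- cocycle with values in N.
  obtain ⟨q, hq⟩ := ih _ hQ ((LieSubmodule.Quotient.mk' N : M →ₗ[ℂ] M ⧸ N) ∘ₗ f)
    (fun x y => by
      simp only [LinearMap.comp_apply, hf, map_sub, LieModuleHom.coe_toLinearMap,
        LieModuleHom.map_lie]) rfl
  obtain ⟨m, rfl⟩ := LieSubmodule.Quotient.surjective_mk' N q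
  let g : L →ₗ[ℂ] M := f - (LieModule.toModuleHom ℂ L M : L ⊗[ℂ] M →ₗ[ℂ] M) ∘ₗ
    (TensorProduct.mk ℂ L M).flip m
  have hg : ∀ x, g x = f x - ⁅x, m⁆ := fun x => by simp [g]
  have hgN : ∀ x, g x ∈ N := fun x => by
    rw [← LieSubmodule.Quotient.mk_eq_zero, hg, map_sub, LieModuleHom.map_lie, sub_eq_zero]
    exact hq x
  obtain ⟨k, hk⟩ := ih _ hNlt (M := N) (g.codRestrict N.toSubmodule hgN) (fun x y => by
    apply Subtype.ext
    change g ⁅x, y⁆ = ⁅x, g y⁆ - ⁅y, g x⁆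
    rw [hg, hg, hg, hf, lie_lie, lie_sub, lie_sub]
    abel) rfl
  refine ⟨m + k, fun x => ?_⟩
  have := congrArg Subtype.val (hk x)
  change g x = ⁅x, (k : M)⁆ at this
  rw [lie_add, ← this, hg]
  abel

/-- **Schur's lemma** for the adjoint representation of a simple Lie algebra. -/
theorem exists_eq_smul_of_map_lie {L : Type*} [LieRing L] [LieAlgebra ℂ L] [FiniteDimensional ℂ L]
    [LieAlgebra.IsSimple ℂ L] (φ : L →ₗ[ℂ] L) (hφ : ∀ x y : L, φ ⁅x, y⁆ = ⁅x, φ y⁆) :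
    ∃ c : ℂ, ∀ x : L, φ x = c • x := by
  have := LieAlgebra.IsSimple.nontrivial ℂ L
  obtain ⟨c, hc⟩ := Module.End.exists_eigenvalue φ
  refine ⟨c, fun x => ?_⟩
  -- An eigenspace of an equivariant endomorphism is an ideal, and here it is nonzero.
  let I : LieIdeal ℂ L :=
    { Module.End.eigenspace φ c with
      lie_mem := fun {x m} hm => by
        change ⁅x, m⁆ ∈ Module.End.eigenspace φ c
        replace hm : m ∈ Module.End.eigenspace φ c := hm
        rw [Module.End.mem_eigenspace_iff] at hm ⊢
        rw [hφ, hm, lie_smul] }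
  have hI : I ≠ ⊥ := fun h => by
    obtain ⟨v, hv⟩ := hc.exists_hasEigenvector
    have : v ∈ I := hv.1
    rw [h] at this
    exact hv.2 (by simpa using this)
  have hx : x ∈ I := (LieAlgebra.IsSimple.eq_bot_or_eq_top I).resolve_left hI ▸
    LieSubmodule.mem_top x
  exact Module.End.mem_eigenspace_iff.1 hx

/-! ### The cocommutative bialgebra structure of the enveloping algebra. -/

section EnvelopingBasics

variable {L : Type*} [LieRing L] [LieAlgebra ℂ L]

theorem envAlgHom_ext {A : Type*} [Ring A] [Algebra ℂ A]
    {f g : UniversalEnvelopingAlgebra ℂ L →ₐ[ℂ] A} (h : ∀ x, f (envι L x) = g (envι L x)) :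
    f = g := by
  let _ := LieRing.ofAssociativeRing (A := A)
  apply UniversalEnvelopingAlgebra.hom_ext
  ext x
  exact h x

/-- The elements satisfying `P` form a subalgebra containing L; the universal property gives a map
into it whose composite with the inclusion is the identity. -/
theorem env_induction {P : UniversalEnvelopingAlgebra ℂ L → Prop}
    (algebraMap : ∀ c : ℂ, P (algebraMap ℂ _ c)) (ι : ∀ x, P (envι L x))
    (mul : ∀ a b, P a → P b → P (a * b)) (add : ∀ a b, P a → P b → P (a + b))
    (a : UniversalEnvelopingAlgebra ℂ L) : P a := by
  let S : Subalgebra ℂ (UniversalEnvelopingAlgebra ℂ L) :=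
    { carrier := {a | P a}
      mul_mem' := fun {a b} => mul a b
      add_mem' := fun {a b} => add a b
      algebraMap_mem' := algebraMap }
  let _ := LieRing.ofAssociativeRing (A := S)
  let f : UniversalEnvelopingAlgebra ℂ L →ₐ[ℂ] S := UniversalEnvelopingAlgebra.lift ℂ
    { (envι L).codRestrict (Subalgebra.toSubmodule S) ι with
      map_lie' := by
        intro x y
        apply Subtype.ext
        exact envι_lie L x y }
  have hf : S.val.comp f = AlgHom.id ℂ _ := by
    apply envAlgHom_ext
    intro x
    exact congrArg S.val (UniversalEnvelopingAlgebra.lift_ι_apply ℂ _ x)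
  rw [← AlgHom.id_apply (R := ℂ) a, ← hf]
  exact (f a).2

local notation "U" => UniversalEnvelopingAlgebra ℂ L

variable (L) in
/-- The multiplication `U(L) ⊗ U(L) → U(L)`. -/
abbrev envMul : U ⊗[ℂ] U →ₗ[ℂ] U := LinearMap.mul' ℂ U

variable (L) in
/-- The second Adams operation `ψ = m ∘ Δ` of `U(L)`. -/
def adams : U →ₗ[ℂ] U := envMul L ∘ₗ (envComul L).toLinearMap

theorem adams_apply (a : U) : adams L a = envMul L (envComul L a) := rfl

theorem comm_envComul (a : U) :
    TensorProduct.comm ℂ U U (envComul L a) = envComul L a := by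
  have : (Algebra.TensorProduct.comm ℂ U U).toAlgHom.comp (envComul L) = envComul L := by
    apply envAlgHom_ext
    intro x
    simp [envComul_ι, add_comm]
  exact DFunLike.congr_fun this a

theorem envComul_coassoc (a : U) :
    (TensorProduct.assoc ℂ U U U) ((envComul L).toLinearMap.rTensor U (envComul L a)) =
      (envComul L).toLinearMap.lTensor U (envComul L a) := by
  have : ((Algebra.TensorProduct.assoc ℂ ℂ ℂ U U U).toAlgHom.comp
      (Algebra.TensorProduct.map (envComul L) (AlgHom.id ℂ U))).comp (envComul L) =
      (Algebra.TensorProduct.map (AlgHom.id ℂ U) (envComul L)).comp (envComul L) := by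
    apply envAlgHom_ext
    intro x
    simp [envComul_ι, TensorProduct.add_tmul, TensorProduct.tmul_add, Algebra.TensorProduct.one_def,
      add_assoc]
  exact DFunLike.congr_fun this a

theorem leftComm_envComul (a : U) :
    TensorProduct.leftComm ℂ U U U ((envComul L).toLinearMap.lTensor U (envComul L a)) =
      (envComul L).toLinearMap.lTensor U (envComul L a) := by
  have : ((Algebra.TensorProduct.leftComm ℂ U U U).toAlgHom.comp
      (Algebra.TensorProduct.map (AlgHom.id ℂ U) (envComul L))).comp (envComul L) =
      (Algebra.TensorProduct.map (AlgHom.id ℂ U) (envComul L)).comp (envComul L) := by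
    apply envAlgHom_ext
    intro x
    simp [envComul_ι, TensorProduct.tmul_add, Algebra.TensorProduct.one_def]
    abel
  exact DFunLike.congr_fun this a

theorem envCounit_lid (a : U) :
    (TensorProduct.lid ℂ U) ((envCounit L).toLinearMap.rTensor U (envComul L a)) = a := by
  have : ((Algebra.TensorProduct.lid ℂ U).toAlgHom.comp
      (Algebra.TensorProduct.map (envCounit L) (AlgHom.id ℂ U))).comp (envComul L) =
      AlgHom.id ℂ U := by
    apply envAlgHom_ext
    intro x
    simp [envComul_ι, envCounit_ι]
  exact DFunLike.congr_fun this a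

end EnvelopingBasics

/-! ### The standard filtration, the Adams operation and primitive elements. -/

section Filtration

variable (L : Type*) [LieRing L] [LieAlgebra ℂ L]
local notation "U" => UniversalEnvelopingAlgebra ℂ L

/-- The standard filtration of `U(L)`: the span of the products of at most `n` elements of `L`. -/
def envFil (n : ℕ) : Submodule ℂ U := (1 ⊔ LinearMap.range (envι L)) ^ n

/-- The filtration of `U(L) ⊗ U(L)` by total degree. -/
def envTensorFil (n : ℕ) : Submodule ℂ (U ⊗[ℂ] U) :=
  Submodule.span ℂ {t | ∃ i j, i + j = n ∧ ∃ a ∈ envFil L i, ∃ b ∈ envFil L j, t = a ⊗ₜ b}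

variable {L}

theorem envFil_zero : envFil L 0 = 1 := pow_zero _

theorem algebraMap_mem_envFil (c : ℂ) (n : ℕ) : algebraMap ℂ U c ∈ envFil L n := by
  have h : (1 : Submodule ℂ U) ≤ envFil L n := by
    rw [envFil]
    exact one_le_pow_of_one_le' le_sup_left n
  exact h (Submodule.algebraMap_mem c)

theorem ι_mem_envFil (x : L) : envι L x ∈ envFil L 1 := by
  rw [envFil, pow_one]
  exact Submodule.mem_sup_right ⟨x, rfl⟩

theorem mul_mem_envFil {m n : ℕ} {a b : U} (ha : a ∈ envFil L m) (hb : b ∈ envFil L n) :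
    a * b ∈ envFil L (m + n) := by
  rw [envFil, pow_add]
  exact Submodule.mul_mem_mul ha hb

theorem envFil_mono {m n : ℕ} (h : m ≤ n) : envFil L m ≤ envFil L n := by
  obtain ⟨k, rfl⟩ := Nat.exists_eq_add_of_le h
  intro a ha
  simpa using mul_mem_envFil ha (algebraMap_mem_envFil 1 k)

theorem mem_envFil_zero {a : U} (h : a ∈ envFil L 0) : ∃ c : ℂ, a = algebraMap ℂ U c := by
  rw [envFil_zero, Submodule.mem_one] at h
  obtain ⟨c, rfl⟩ := h
  exact ⟨c, rfl⟩

/-- Induction along the filtration. -/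
theorem envFil_succ_induction {n : ℕ} {P : U → Prop} (base : ∀ a ∈ envFil L n, P a)
    (ι_mul : ∀ (x : L), ∀ a ∈ envFil L n, P (envι L x * a))
    (add : ∀ a b, P a → P b → P (a + b)) {a : U} (ha : a ∈ envFil L (n + 1)) : P a := by
  rw [envFil, pow_succ'] at ha
  induction ha using Submodule.mul_induction_on' with
  | mem_mul_mem f hf a ha =>
    obtain ⟨c, hc, y, ⟨x, rfl⟩, rfl⟩ := Submodule.mem_sup.1 hf
    obtain ⟨c, rfl⟩ := Submodule.mem_one.1 hc
    rw [add_mul]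
    refine add _ _ (base _ ?_) (ι_mul x a ha)
    rw [← Algebra.smul_def]
    exact Submodule.smul_mem _ c ha
  | add a _ b _ ha hb => exact add a b ha hb

theorem exists_mem_envFil (a : U) : ∃ n, a ∈ envFil L n := by
  induction a using env_induction with
  | algebraMap c => exact ⟨0, algebraMap_mem_envFil c 0⟩
  | ι x => exact ⟨1, ι_mem_envFil x⟩
  | mul a b ha hb =>
    obtain ⟨m, hm⟩ := ha
    obtain ⟨n, hn⟩ := hb
    exact ⟨m + n, mul_mem_envFil hm hn⟩
  | add a b ha hb =>
    obtain ⟨m, hm⟩ := ha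
    obtain ⟨n, hn⟩ := hb
    exact ⟨m + n, add_mem (envFil_mono (by omega) hm) (envFil_mono (by omega) hn)⟩

theorem tmul_mem_envTensorFil {i j : ℕ} {a b : U} (ha : a ∈ envFil L i) (hb : b ∈ envFil L j) :
    a ⊗ₜ[ℂ] b ∈ envTensorFil L (i + j) :=
  Submodule.subset_span ⟨i, j, rfl, a, ha, b, hb, rfl⟩

theorem envTensorFil_mono {m n : ℕ} (h : m ≤ n) : envTensorFil L m ≤ envTensorFil L n := by
  rw [envTensorFil, Submodule.span_le]
  rintro _ ⟨i, j, rfl, a, ha, b, hb, rfl⟩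
  exact Submodule.subset_span ⟨i, n - i, by omega, a, ha, b, envFil_mono (by omega) hb, rfl⟩

theorem exists_mem_envTensorFil (t : U ⊗[ℂ] U) : ∃ n, t ∈ envTensorFil L n := by
  induction t using TensorProduct.induction_on with
  | zero => exact ⟨0, zero_mem _⟩
  | tmul a b =>
    obtain ⟨m, hm⟩ := exists_mem_envFil a
    obtain ⟨n, hn⟩ := exists_mem_envFil b
    exact ⟨m + n, tmul_mem_envTensorFil hm hn⟩
  | add s t hs ht =>
    obtain ⟨m, hm⟩ := hs
    obtain ⟨n, hn⟩ := ht
    exact ⟨m + n, add_mem (envTensorFil_mono (by omega) hm) (envTensorFil_mono (by omega) hn)⟩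

theorem envComul_mem {n : ℕ} {a : U} (ha : a ∈ envFil L n) : envComul L a ∈ envTensorFil L n := by
  induction n generalizing a with
  | zero =>
    obtain ⟨c, rfl⟩ := mem_envFil_zero ha
    rw [AlgHom.commutes, Algebra.TensorProduct.algebraMap_apply]
    refine Submodule.subset_span ⟨0, 0, rfl, _, algebraMap_mem_envFil c 0, 1, ?_, rfl⟩
    simpa using algebraMap_mem_envFil (L := L) 1 0
  | succ n ih =>
    refine envFil_succ_induction (P := fun a => envComul L a ∈ envTensorFil L (n + 1))
      (fun a ha => envTensorFil_mono n.le_succ (ih ha)) (fun x a ha => ?_)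
      (fun a b ha hb => by rw [map_add]; exact add_mem ha hb) ha
    rw [map_mul, envComul_ι]
    have h := ih ha
    revert h
    generalize envComul L a = t
    intro h
    induction h using Submodule.span_induction with
    | mem t ht =>
      obtain ⟨i, j, rfl, a, ha, b, hb, rfl⟩ := ht
      rw [add_mul, Algebra.TensorProduct.tmul_mul_tmul, Algebra.TensorProduct.tmul_mul_tmul,
        one_mul, one_mul]
      refine add_mem ?_ ?_
      · rw [show i + j + 1 = (1 + i) + j by omega]
        exact tmul_mem_envTensorFil (mul_mem_envFil (ι_mem_envFil x) ha) hb
      · rw [show i + j + 1 = i + (1 + j) by omega]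
        exact tmul_mem_envTensorFil ha (mul_mem_envFil (ι_mem_envFil x) hb)
    | zero => simp
    | add s t _ _ hs ht => rw [mul_add]; exact add_mem hs ht
    | smul c t _ ht => rw [mul_smul_comm]; exact Submodule.smul_mem _ c ht

theorem commutator_mem {n : ℕ} {a : U} (ha : a ∈ envFil L n) (x : L) :
    a * envι L x - envι L x * a ∈ envFil L n := by
  induction n generalizing a with
  | zero =>
    obtain ⟨c, rfl⟩ := mem_envFil_zero ha
    rw [Algebra.commutes, sub_self]
    exact zero_mem _
  | succ n ih =>
    refine envFil_succ_induction
      (P := fun a => a * envι L x - envι L x * a ∈ envFil L (n + 1))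
      (fun a ha => envFil_mono n.le_succ (ih ha)) (fun y a ha => ?_)
      (fun a b ha hb => by rw [add_mul, mul_add, add_sub_add_comm]; exact add_mem ha hb) ha
    have : envι L y * a * envι L x - envι L x * (envι L y * a) =
        envι L y * (a * envι L x - envι L x * a) + envι L ⁅y, x⁆ * a := by
      rw [envι_lie]
      noncomm_ring
    rw [this, add_comm n 1]
    exact add_mem (mul_mem_envFil (ι_mem_envFil _) (ih ha)) (mul_mem_envFil (ι_mem_envFil _) ha)

theorem adams_algebraMap (c : ℂ) : adams L (algebraMap ℂ U c) = algebraMap ℂ U c := by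
  rw [adams_apply, AlgHom.commutes, Algebra.TensorProduct.algebraMap_apply]
  simp

/-- With Δ(a) = ∑ a' ⊗ a'', the difference is ∑ [a', x] a'', and commutators with elements of L do
not raise the filtration degree. -/
theorem adams_ι_mul_sub_mem {n : ℕ} {a : U} (ha : a ∈ envFil L n) (x : L) :
    adams L (envι L x * a) - (2 : ℂ) • (envι L x * adams L a) ∈ envFil L n := by
  rw [adams_apply, adams_apply, map_mul, envComul_ι]
  have h := envComul_mem ha
  revert h
  generalize envComul L a = t
  intro h
  induction h using Submodule.span_induction with
  | mem t ht =>
    obtain ⟨i, j, rfl, a, ha, b, hb, rfl⟩ := ht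
    have : envMul L ((envι L x ⊗ₜ 1 + 1 ⊗ₜ envι L x) * a ⊗ₜ[ℂ] b) -
        (2 : ℂ) • (envι L x * envMul L (a ⊗ₜ[ℂ] b)) = (a * envι L x - envι L x * a) * b := by
      rw [add_mul, Algebra.TensorProduct.tmul_mul_tmul, Algebra.TensorProduct.tmul_mul_tmul,
        map_add, two_smul]
      simp only [LinearMap.mul'_apply]
      noncomm_ring
    rw [this]
    exact mul_mem_envFil (commutator_mem ha x) hb
  | zero => simp
  | add s t _ _ hs ht =>
    rw [mul_add, map_add, map_add, mul_add, smul_add, add_sub_add_comm]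
    exact add_mem hs ht
  | smul c t _ ht =>
    rw [mul_smul_comm, map_smul, map_smul, mul_smul_comm, smul_comm (2 : ℂ) c, ← smul_sub]
    exact Submodule.smul_mem _ c ht

/-- Each further factor from L contributes a factor 2 to ψ, up to lower terms. Degree zero is
excluded because nothing lies below it; there ψ fixes the constants exactly. -/
theorem adams_sub_mem {n : ℕ} {a : U} (ha : a ∈ envFil L (n + 1)) :
    adams L a - (2 ^ (n + 1) : ℂ) • a ∈ envFil L n := by
  induction n generalizing a with
  | zero =>
    refine envFil_succ_induction (P := fun a => adams L a - (2 ^ (0 + 1) : ℂ) • a ∈ envFil L 0)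
      (fun a ha => ?_) (fun x a ha => ?_) (fun a b ha hb => by
        rw [map_add, smul_add, add_sub_add_comm]; exact add_mem ha hb) ha
    · obtain ⟨c, rfl⟩ := mem_envFil_zero ha
      rw [adams_algebraMap]
      exact sub_mem ha (Submodule.smul_mem _ _ ha)
    · have h := adams_ι_mul_sub_mem ha x
      obtain ⟨c, rfl⟩ := mem_envFil_zero ha
      simpa [adams_algebraMap] using h
  | succ n ih =>
    refine envFil_succ_induction
      (P := fun a => adams L a - (2 ^ (n + 1 + 1) : ℂ) • a ∈ envFil L (n + 1))
      (fun a ha => ?_) (fun x a ha => ?_) (fun a b ha hb => by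
        rw [map_add, smul_add, add_sub_add_comm]; exact add_mem ha hb) ha
    · have h := add_mem (envFil_mono n.le_succ (ih ha))
        (Submodule.smul_mem _ ((2 ^ (n + 1) : ℂ) - 2 ^ (n + 1 + 1)) ha)
      rw [sub_smul] at h
      simpa using h
    · have h := add_mem (adams_ι_mul_sub_mem ha x)
        (Submodule.smul_mem _ (2 : ℂ)
          (envFil_mono (add_comm 1 n).le (mul_mem_envFil (ι_mem_envFil x) (ih ha))))
      rw [mul_sub, smul_sub, mul_smul_comm, smul_smul, ← pow_succ'] at h
      simpa using h

/-- The operator `ψ ⊗ ψ` acts on the associated graded space of degree `n` as `2ⁿ`. -/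
theorem map_adams_sub_mem {n : ℕ} {t : U ⊗[ℂ] U} (ht : t ∈ envTensorFil L (n + 1)) :
    TensorProduct.map (adams L) (adams L) t - (2 ^ (n + 1) : ℂ) • t ∈ envTensorFil L n := by
  have hmem : ∀ {i : ℕ} {a : U}, a ∈ envFil L i → adams L a ∈ envFil L i := by
    intro i a ha
    cases i with
    | zero =>
      obtain ⟨c, rfl⟩ := mem_envFil_zero ha
      rwa [adams_algebraMap]
    | succ i =>
      have := add_mem (envFil_mono i.le_succ (adams_sub_mem ha))
        (Submodule.smul_mem _ (2 ^ (i + 1) : ℂ) ha)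
      simpa using this
  induction ht using Submodule.span_induction with
  | mem t ht =>
    obtain ⟨i, j, hij, a, ha, b, hb, rfl⟩ := ht
    -- Telescoping 2ⁿ⁺¹ = 2ⁱ 2ʲ: each summand contains one factor of lower degree, or vanishes if
    -- that factor is a constant.
    have key : TensorProduct.map (adams L) (adams L) (a ⊗ₜ b) - (2 ^ (n + 1) : ℂ) • a ⊗ₜ[ℂ] b =
        (adams L a - (2 ^ i : ℂ) • a) ⊗ₜ adams L b +
          (2 ^ i : ℂ) • a ⊗ₜ[ℂ] (adams L b - (2 ^ j : ℂ) • b) := by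
      rw [TensorProduct.map_tmul, ← hij, pow_add, TensorProduct.sub_tmul, TensorProduct.tmul_sub,
        smul_sub, TensorProduct.tmul_smul, ← TensorProduct.smul_tmul', smul_smul]
      abel
    rw [key]
    refine add_mem ?_ (Submodule.smul_mem _ _ ?_)
    · cases i with
      | zero =>
        obtain ⟨c, rfl⟩ := mem_envFil_zero ha
        simp [adams_algebraMap]
      | succ i =>
        obtain rfl : i + j = n := by omega
        exact tmul_mem_envTensorFil (adams_sub_mem ha) (hmem hb)
    · cases j with
      | zero =>
        obtain ⟨c, rfl⟩ := mem_envFil_zero hb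
        simp [adams_algebraMap]
      | succ j =>
        obtain rfl : i + j = n := by omega
        exact tmul_mem_envTensorFil ha (adams_sub_mem hb)
  | zero => simp
  | add s t _ _ hs ht =>
    rw [map_add, smul_add, add_sub_add_comm]
    exact add_mem hs ht
  | smul c t _ ht =>
    rw [map_smul, smul_comm _ c, ← smul_sub]
    exact Submodule.smul_mem _ c ht

/-- The primitive elements of `U(L)` are the elements of `L`. -/
theorem exists_ι_of_primitive {a : U} (ha : envComul L a = a ⊗ₜ 1 + 1 ⊗ₜ a) :
    ∃ x, envι L x = a := by
  have hψ : adams L a = (2 : ℂ) • a := by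
    rw [adams_apply, ha, two_smul]
    simp
  obtain ⟨n, hn⟩ : ∃ n, a ∈ envFil L (n + 1) := by
    obtain ⟨n, hn⟩ := exists_mem_envFil a
    exact ⟨n, envFil_mono n.le_succ hn⟩
  have h1 : a ∈ envFil L 1 := by
    induction n with
    | zero => exact hn
    | succ n ih =>
      apply ih
      -- The eigenvalue 2 differs from 2ⁿ⁺² in the top degree, so `a` already lies one step lower.
      have h := adams_sub_mem hn
      rw [hψ, ← sub_smul] at h
      refine (Submodule.smul_mem_iff _ ?_).1 h
      rw [pow_succ, sub_ne_zero]
      intro h2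
      have h3 : (2 : ℂ) ^ (n + 1) = 1 := by linear_combination -h2 / 2
      have h4 : (2 : ℕ) ^ (n + 1) = 1 := by exact_mod_cast h3
      simp at h4
  rw [envFil, pow_one] at h1
  obtain ⟨c, hc, y, ⟨x, rfl⟩, rfl⟩ := Submodule.mem_sup.1 h1
  obtain ⟨c, rfl⟩ := Submodule.mem_one.1 hc
  have h2 : adams L (envι L x) = (2 : ℂ) • envι L x := by
    rw [adams_apply, envComul_ι, two_smul]
    simp
  -- On constants ψ has eigenvalue 1, not 2, which removes the constant term.
  rw [map_add, adams_algebraMap, h2, smul_add, add_left_inj, two_smul] at hψ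
  exact ⟨x, by rw [left_eq_add.1 hψ, zero_add]⟩

end Filtration
-- Symmetric two-cocycles of the cobar complex.
section Cobar

variable {L : Type*} [LieRing L] [LieAlgebra ℂ L]
local notation "U" => UniversalEnvelopingAlgebra ℂ L

variable (L) in
/-- The differential `w ↦ Δ(w) - w ⊗ 1 - 1 ⊗ w` of the cobar complex of `U(L)`. -/
def cobarOne : U →ₗ[ℂ] U ⊗[ℂ] U :=
  (envComul L).toLinearMap - (TensorProduct.mk ℂ U U).flip 1 - TensorProduct.mk ℂ U U 1

theorem cobarOne_apply (w : U) : cobarOne L w = envComul L w - w ⊗ₜ 1 - 1 ⊗ₜ w := rfl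

variable (L) in
/-- The differential `S ↦ 1 ⊗ S + (id ⊗ Δ)(S) - S ⊗ 1 - (Δ ⊗ id)(S)` of the cobar complex. -/
def cobarTwo : U ⊗[ℂ] U →ₗ[ℂ] U ⊗[ℂ] (U ⊗[ℂ] U) :=
  TensorProduct.mk ℂ U (U ⊗[ℂ] U) 1 + (envComul L).toLinearMap.lTensor U -
    ((TensorProduct.assoc ℂ U U U).toLinearMap ∘ₗ (TensorProduct.mk ℂ (U ⊗[ℂ] U) U).flip 1 +
      (TensorProduct.assoc ℂ U U U).toLinearMap ∘ₗ (envComul L).toLinearMap.rTensor U)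

theorem cobarTwo_apply (S : U ⊗[ℂ] U) :
    cobarTwo L S = 1 ⊗ₜ S + (envComul L).toLinearMap.lTensor U S -
      (TensorProduct.assoc ℂ U U U (S ⊗ₜ 1) +
        TensorProduct.assoc ℂ U U U ((envComul L).toLinearMap.rTensor U S)) := rfl

theorem cobarTwo_cobarOne (w : U) : cobarTwo L (cobarOne L w) = 0 := by
  rw [cobarOne_apply, cobarTwo_apply]
  simp only [map_sub, TensorProduct.sub_tmul, TensorProduct.tmul_sub, envComul_coassoc,
    LinearMap.lTensor_tmul, LinearMap.rTensor_tmul, AlgHom.toLinearMap_apply, map_one,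
    Algebra.TensorProduct.one_def, TensorProduct.assoc_tmul]
  abel

theorem comm_cobarOne (w : U) : TensorProduct.comm ℂ U U (cobarOne L w) = cobarOne L w := by
  simp only [cobarOne_apply, map_sub, comm_envComul, TensorProduct.comm_tmul]
  abel

theorem cobarTwo_ι_tmul_ι (x y : L) : cobarTwo L (envι L x ⊗ₜ envι L y) = 0 := by
  rw [cobarTwo_apply]
  simp only [LinearMap.lTensor_tmul, LinearMap.rTensor_tmul, AlgHom.toLinearMap_apply, envComul_ι,
    TensorProduct.tmul_add, TensorProduct.add_tmul, map_add, TensorProduct.assoc_tmul]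
  abel

/-- `a ⊗ b ⊗ c ↦ ab ⊗ ψ(c)` -/
def collapseLeft : U ⊗[ℂ] (U ⊗[ℂ] U) →ₗ[ℂ] U ⊗[ℂ] U :=
  TensorProduct.map (envMul L) (adams L) ∘ₗ (TensorProduct.assoc ℂ U U U).symm.toLinearMap

/-- `a ⊗ b ⊗ c ↦ a ⊗ bc` -/
def collapseRight : U ⊗[ℂ] (U ⊗[ℂ] U) →ₗ[ℂ] U ⊗[ℂ] U :=
  (envMul L).lTensor U

/-- `a ⊗ b ⊗ c ↦ (a ⊗ b) Δ(c)` -/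
def collapseDiag : U ⊗[ℂ] (U ⊗[ℂ] U) →ₗ[ℂ] U ⊗[ℂ] U :=
  LinearMap.mul' ℂ (U ⊗[ℂ] U) ∘ₗ (envComul L).toLinearMap.lTensor (U ⊗[ℂ] U) ∘ₗ
    (TensorProduct.assoc ℂ U U U).symm.toLinearMap

/-- `a ⊗ b ⊗ c ↦ b ⊗ ac` -/
def collapseSwap : U ⊗[ℂ] (U ⊗[ℂ] U) →ₗ[ℂ] U ⊗[ℂ] U :=
  collapseRight ∘ₗ (TensorProduct.leftComm ℂ U U U).toLinearMap

@[simp] theorem collapseLeft_tmul (a b c : U) :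
    collapseLeft (a ⊗ₜ[ℂ] (b ⊗ₜ[ℂ] c)) = (a * b) ⊗ₜ adams L c := by simp [collapseLeft]

@[simp] theorem collapseRight_tmul (a b c : U) :
    collapseRight (a ⊗ₜ[ℂ] (b ⊗ₜ[ℂ] c)) = a ⊗ₜ (b * c) := by simp [collapseRight]

@[simp] theorem collapseDiag_tmul (a b c : U) :
    collapseDiag (a ⊗ₜ[ℂ] (b ⊗ₜ[ℂ] c)) = (a ⊗ₜ b) * envComul L c := by simp [collapseDiag]

@[simp] theorem collapseSwap_tmul (a b c : U) :
    collapseSwap (a ⊗ₜ[ℂ] (b ⊗ₜ[ℂ] c)) = b ⊗ₜ (a * c) := by simp [collapseSwap]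

/-- This and the next three lemmas turn the cocycle equation into four relations in U ⊗ U, chosen so
that a signed sum eliminates every term except S, (ψ ⊗ ψ)(S) and the coboundary of m(S). -/
theorem collapseLeft_cobarTwo (S : U ⊗[ℂ] U) :
    collapseLeft (cobarTwo L S) = (adams L).lTensor U S +
      collapseLeft ((envComul L).toLinearMap.lTensor U S) -
        (envMul L S ⊗ₜ 1 + TensorProduct.map (adams L) (adams L) S) := by
  have h : ∀ (t : U ⊗[ℂ] U) (c : U),
      collapseLeft (TensorProduct.assoc ℂ U U U (t ⊗ₜ c)) = envMul L t ⊗ₜ adams L c := by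
    intro t c
    simp [collapseLeft]
  have h1 : ∀ S : U ⊗[ℂ] U, collapseLeft (1 ⊗ₜ S) = (adams L).lTensor U S := by
    intro S
    induction S using TensorProduct.induction_on with
    | zero => simp
    | tmul p q => simp
    | add S T hS hT => simp only [TensorProduct.tmul_add, map_add, hS, hT]
  have h2 : ∀ S : U ⊗[ℂ] U,
      collapseLeft (TensorProduct.assoc ℂ U U U ((envComul L).toLinearMap.rTensor U S)) =
        TensorProduct.map (adams L) (adams L) S := by
    intro S
    induction S using TensorProduct.induction_on with
    | zero => simp
    | tmul p q => rw [LinearMap.rTensor_tmul, h]; rfl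
    | add S T hS hT => simp only [map_add, hS, hT]
  have h3 : adams L (1 : U) = 1 := by simpa using adams_algebraMap (L := L) 1
  rw [cobarTwo_apply, map_sub, map_add, map_add, h, h1, h2, h3]

theorem collapseRight_cobarTwo (S : U ⊗[ℂ] U) :
    collapseRight (cobarTwo L S) = 1 ⊗ₜ envMul L S + (adams L).lTensor U S -
      (S + collapseRight (TensorProduct.assoc ℂ U U U ((envComul L).toLinearMap.rTensor U S))) := by
  have h1 : collapseRight (1 ⊗ₜ S) = (1 : U) ⊗ₜ[ℂ] envMul L S := rfl
  have h2 : collapseRight ((envComul L).toLinearMap.lTensor U S) = (adams L).lTensor U S := by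
    rw [adams, LinearMap.lTensor_comp]; rfl
  have h3 : ∀ S : U ⊗[ℂ] U, collapseRight (TensorProduct.assoc ℂ U U U (S ⊗ₜ 1)) = S := by
    intro S
    induction S using TensorProduct.induction_on with
    | zero => simp
    | tmul p q => simp
    | add S T hS hT => simp only [TensorProduct.add_tmul, map_add, hS, hT]
  rw [cobarTwo_apply, map_sub, map_add, map_add, h1, h2, h3]

theorem collapseDiag_cobarTwo (S : U ⊗[ℂ] U) :
    collapseDiag (cobarTwo L S) = collapseSwap ((envComul L).toLinearMap.lTensor U S) +
      collapseDiag ((envComul L).toLinearMap.lTensor U S) - (S + envComul L (envMul L S)) := by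
  have h : ∀ (t : U ⊗[ℂ] U) (c : U),
      collapseDiag (TensorProduct.assoc ℂ U U U (t ⊗ₜ c)) = t * envComul L c := by
    intro t c
    simp [collapseDiag]
  have h0 : ∀ (p : U) (t : U ⊗[ℂ] U), collapseSwap (p ⊗ₜ t) = (1 ⊗ₜ p) * t := by
    intro p t
    induction t using TensorProduct.induction_on with
    | zero => simp
    | tmul p q => simp
    | add S T hS hT => simp only [TensorProduct.tmul_add, map_add, hS, hT, mul_add]
  have h1 : ∀ S : U ⊗[ℂ] U, collapseDiag (1 ⊗ₜ S) =
      collapseSwap ((envComul L).toLinearMap.lTensor U S) := by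
    intro S
    induction S using TensorProduct.induction_on with
    | zero => simp
    | tmul p q => simp [h0]
    | add S T hS hT => simp only [TensorProduct.tmul_add, map_add, hS, hT]
  have h2 : ∀ S : U ⊗[ℂ] U,
      collapseDiag (TensorProduct.assoc ℂ U U U ((envComul L).toLinearMap.rTensor U S)) =
        envComul L (envMul L S) := by
    intro S
    induction S using TensorProduct.induction_on with
    | zero => simp
    | tmul p q => simp [h]
    | add S T hS hT => simp only [map_add, hS, hT]
  rw [cobarTwo_apply, map_sub, map_add, map_add, h, h1, h2, map_one, mul_one]

theorem collapseSwap_cobarTwo (S : U ⊗[ℂ] U) :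
    collapseSwap (cobarTwo L S) = S + collapseSwap ((envComul L).toLinearMap.lTensor U S) -
      (TensorProduct.comm ℂ U U S +
        collapseRight (TensorProduct.assoc ℂ U U U ((envComul L).toLinearMap.rTensor U S))) := by
  have h1 : ∀ S : U ⊗[ℂ] U, collapseSwap (1 ⊗ₜ S) = S := by
    intro S
    induction S using TensorProduct.induction_on with
    | zero => simp
    | tmul p q => simp
    | add S T hS hT => simp only [TensorProduct.tmul_add, map_add, hS, hT]
  have h2 : ∀ S : U ⊗[ℂ] U, collapseSwap (TensorProduct.assoc ℂ U U U (S ⊗ₜ 1)) =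
      TensorProduct.comm ℂ U U S := by
    intro S
    induction S using TensorProduct.induction_on with
    | zero => simp
    | tmul p q => simp
    | add S T hS hT => simp only [TensorProduct.add_tmul, map_add, hS, hT]
  have h3 : ∀ (t : U ⊗[ℂ] U) (q : U), collapseSwap (TensorProduct.assoc ℂ U U U (t ⊗ₜ q)) =
      collapseRight (TensorProduct.assoc ℂ U U U (TensorProduct.comm ℂ U U t ⊗ₜ q)) := by
    intro t q
    induction t using TensorProduct.induction_on with
    | zero => simp
    | tmul a b => simp
    | add S T hS hT => simp only [TensorProduct.add_tmul, map_add, hS, hT]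
  -- Cocommutativity enters here: exchanging the two halves of Δ(p) changes nothing, so this term
  -- cancels against the one from `collapseRight_cobarTwo`.
  have h4 : ∀ S : U ⊗[ℂ] U,
      collapseSwap (TensorProduct.assoc ℂ U U U ((envComul L).toLinearMap.rTensor U S)) =
        collapseRight (TensorProduct.assoc ℂ U U U ((envComul L).toLinearMap.rTensor U S)) := by
    intro S
    induction S using TensorProduct.induction_on with
    | zero => simp
    | tmul p q =>
      rw [LinearMap.rTensor_tmul, h3, AlgHom.toLinearMap_apply, comm_envComul]
    | add S T hS hT => simp only [map_add, hS, hT]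
  rw [cobarTwo_apply, map_sub, map_add, map_add, h1, h2, h4]

/-- On p ⊗ q the two sides are ∑ p q₁ ⊗ q₂ q₃ and ∑ p q₂ ⊗ q₁ q₃, which agree by cocommutativity. -/
theorem collapseLeft_lTensor_envComul (S : U ⊗[ℂ] U) :
    collapseLeft ((envComul L).toLinearMap.lTensor U S) =
      collapseDiag ((envComul L).toLinearMap.lTensor U S) := by
  induction S using TensorProduct.induction_on with
  | zero => simp
  | tmul p q =>
    rw [LinearMap.lTensor_tmul, AlgHom.toLinearMap_apply]
    let M : U ⊗[ℂ] (U ⊗[ℂ] U) →ₗ[ℂ] U ⊗[ℂ] U :=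
      TensorProduct.map (LinearMap.mulLeft ℂ p) (envMul L)
    have h1 : ∀ t : U ⊗[ℂ] U,
        collapseLeft (p ⊗ₜ t) = M ((envComul L).toLinearMap.lTensor U t) := by
      intro t
      induction t using TensorProduct.induction_on with
      | zero => simp
      | tmul b c => simp [M, adams_apply]
      | add S T hS hT => simp only [TensorProduct.tmul_add, map_add, hS, hT]
    have h2 : ∀ (b : U) (u : U ⊗[ℂ] U),
        (p ⊗ₜ b) * u = M (TensorProduct.leftComm ℂ U U U (b ⊗ₜ u)) := by
      intro b u
      induction u using TensorProduct.induction_on with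
      | zero => simp
      | tmul b c => simp [M]
      | add S T hS hT => simp only [TensorProduct.tmul_add, map_add, hS, hT, mul_add]
    have h3 : ∀ t : U ⊗[ℂ] U, collapseDiag (p ⊗ₜ t) =
        M (TensorProduct.leftComm ℂ U U U ((envComul L).toLinearMap.lTensor U t)) := by
      intro t
      induction t using TensorProduct.induction_on with
      | zero => simp
      | tmul b c => simp [h2]
      | add S T hS hT => simp only [TensorProduct.tmul_add, map_add, hS, hT]
    rw [h1, h3, leftComm_envComul]
  | add S T hS hT => simp only [map_add, hS, hT]

/-- On symmetric cocycles the second Adams operation is cohomologous to multiplication by `2`. -/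
theorem map_adams_sub_eq_cobarOne {S : U ⊗[ℂ] U} (hS : cobarTwo L S = 0)
    (hsymm : TensorProduct.comm ℂ U U S = S) :
    TensorProduct.map (adams L) (adams L) S - (2 : ℂ) • S = cobarOne L (envMul L S) := by
  have h1 := collapseLeft_cobarTwo S
  have h2 := collapseRight_cobarTwo S
  have h3 := collapseDiag_cobarTwo S
  have h4 := collapseSwap_cobarTwo S
  rw [hS, map_zero] at h1 h2 h3 h4
  rw [hsymm] at h4
  rw [collapseLeft_lTensor_envComul] at h1
  rw [cobarOne_apply, ← sub_eq_zero]
  linear_combination (norm := module) h1 - h2 - h3 + h4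

/-- In this degree S = a ⊗ 1 + 1 ⊗ b. The counit in the middle factor of the cocycle equation forces
`a` and `b` to be scalars, so S is a multiple of 1 ⊗ 1. -/
theorem cobar_degree_one {S : U ⊗[ℂ] U} (hS : cobarTwo L S = 0) (h : S ∈ envTensorFil L 1) :
    ∃ w, S = cobarOne L w := by
  obtain ⟨a, b, rfl⟩ : ∃ a b : U, S = a ⊗ₜ 1 + 1 ⊗ₜ b := by
    clear hS
    induction h using Submodule.span_induction with
    | mem t ht =>
      obtain ⟨i, j, hij, a, ha, b, hb, rfl⟩ := ht
      obtain ⟨rfl, rfl⟩ | ⟨rfl, rfl⟩ : (i = 0 ∧ j = 1) ∨ (i = 1 ∧ j = 0) := by omega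
      · obtain ⟨c, rfl⟩ := mem_envFil_zero ha
        refine ⟨0, c • b, ?_⟩
        rw [Algebra.algebraMap_eq_smul_one, TensorProduct.smul_tmul, TensorProduct.zero_tmul,
          zero_add]
      · obtain ⟨c, rfl⟩ := mem_envFil_zero hb
        refine ⟨c • a, 0, ?_⟩
        rw [Algebra.algebraMap_eq_smul_one, TensorProduct.smul_tmul, TensorProduct.tmul_zero,
          add_zero]
    | zero => exact ⟨0, 0, by simp⟩
    | add s t _ _ hs ht =>
      obtain ⟨a, b, rfl⟩ := hs
      obtain ⟨a', b', rfl⟩ := ht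
      exact ⟨a + a', b + b', by rw [TensorProduct.add_tmul, TensorProduct.tmul_add]; abel⟩
    | smul c t _ ht =>
      obtain ⟨a, b, rfl⟩ := ht
      exact ⟨c • a, c • b, by rw [smul_add, TensorProduct.tmul_smul, TensorProduct.smul_tmul']⟩
  have hε : ∀ a : U, (TensorProduct.lid ℂ U)
      ((envCounit L).toLinearMap.rTensor U (envComul L a)) = a := envCounit_lid
  have hε' : ∀ a : U, (TensorProduct.rid ℂ U)
      ((envCounit L).toLinearMap.lTensor U (envComul L a)) = a := fun a => by
    conv_rhs => rw [← hε a, ← comm_envComul a]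
    generalize envComul L a = t
    induction t using TensorProduct.induction_on with
    | zero => simp
    | tmul b c => simp
    | add S T hS hT => simp only [map_add, hS, hT]
  -- apply the counit to the middle factor, then to one of the outer factors
  let e := (envCounit L).toLinearMap
  have hmid := congrArg ((TensorProduct.lid ℂ U).toLinearMap.lTensor U ∘ₗ
    (e.rTensor U).lTensor U) hS
  have key : ((TensorProduct.lid ℂ U).toLinearMap.lTensor U ∘ₗ (e.rTensor U).lTensor U)
      (cobarTwo L (a ⊗ₜ 1 + 1 ⊗ₜ b)) = 1 ⊗ₜ (e a • 1 + b) - (a + e b • 1) ⊗ₜ 1 := by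
    have h1 : ∀ t : U ⊗[ℂ] U, ((TensorProduct.lid ℂ U).toLinearMap.lTensor U)
        ((e.rTensor U).lTensor U (TensorProduct.assoc ℂ U U U (t ⊗ₜ 1))) =
          (TensorProduct.rid ℂ U (e.lTensor U t)) ⊗ₜ 1 := by
      intro t
      induction t using TensorProduct.induction_on with
      | zero => simp
      | tmul b c => simp [TensorProduct.smul_tmul]
      | add S T hS hT => simp only [TensorProduct.add_tmul, map_add, hS, hT]
    rw [cobarTwo_apply]
    simp only [map_add, LinearMap.lTensor_tmul, LinearMap.rTensor_tmul, AlgHom.toLinearMap_apply,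
      map_one, Algebra.TensorProduct.one_def, TensorProduct.assoc_tmul, LinearMap.comp_apply,
      map_sub, TensorProduct.tmul_add, TensorProduct.add_tmul, h1, LinearEquiv.coe_coe,
      TensorProduct.lid_tmul, e, hε, hε']
    simp
    abel
  rw [key, map_zero, sub_eq_zero] at hmid
  have h1 := congrArg (TensorProduct.lid ℂ U ∘ e.rTensor U) hmid
  have h2 := congrArg (TensorProduct.rid ℂ U ∘ e.lTensor U) hmid
  simp [e] at h1 h2
  have hb : b = envCounit L b • 1 := by
    rw [add_smul, add_right_inj] at h1
    exact h1
  have ha : a = envCounit L a • 1 := by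
    rw [add_smul, add_left_inj] at h2
    exact h2.symm
  -- The sign comes from d(1) = -(1 ⊗ 1).
  refine ⟨-(envCounit L a + envCounit L b) • 1, ?_⟩
  rw [map_smul, cobarOne_apply, map_one, Algebra.TensorProduct.one_def]
  nth_rewrite 1 [ha, hb]
  rw [TensorProduct.tmul_smul, ← TensorProduct.smul_tmul']
  module

/-- A symmetric two-cocycle of the coalgebra `U(L)` is a coboundary. -/
theorem exists_eq_cobarOne {S : U ⊗[ℂ] U} (hS : cobarTwo L S = 0)
    (hsymm : TensorProduct.comm ℂ U U S = S) : ∃ w, S = cobarOne L w := by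
  obtain ⟨n, hn⟩ : ∃ n, S ∈ envTensorFil L (n + 1) := by
    obtain ⟨n, hn⟩ := exists_mem_envTensorFil S
    exact ⟨n, envTensorFil_mono n.le_succ hn⟩
  induction n generalizing S with
  | zero => exact cobar_degree_one hS hn
  | succ n ih =>
    have h := map_adams_sub_eq_cobarOne hS hsymm
    -- `T` has lower degree, and modulo coboundaries it is (2 - 2ⁿ⁺²) S, a nonzero multiple of S.
    set T := TensorProduct.map (adams L) (adams L) S - (2 ^ (n + 1 + 1) : ℂ) • S with hT
    have hT' : T = cobarOne L (envMul L S) + (2 - 2 ^ (n + 1 + 1) : ℂ) • S := by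
      rw [← h, hT, sub_smul]
      abel
    have hT0 : cobarTwo L T = 0 := by
      rw [hT', map_add, cobarTwo_cobarOne, map_smul, hS, smul_zero, add_zero]
    have hTs : TensorProduct.comm ℂ U U T = T := by
      rw [hT', map_add, comm_cobarOne, map_smul, hsymm]
    obtain ⟨w, hw⟩ := ih hT0 hTs (map_adams_sub_mem hn)
    have hne : (2 - 2 ^ (n + 1 + 1) : ℂ) ≠ 0 := by
      rw [pow_succ, sub_ne_zero]
      intro h2
      have h3 : (2 : ℂ) ^ (n + 1) = 1 := by linear_combination -h2 / 2
      have h4 : (2 : ℕ) ^ (n + 1) = 1 := by exact_mod_cast h3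
      simp at h4
    refine ⟨(2 - 2 ^ (n + 1 + 1) : ℂ)⁻¹ • (w - envMul L S), ?_⟩
    rw [map_smul, map_sub, ← hw, hT', add_sub_cancel_left, inv_smul_smul₀ hne]

end Cobar
-- Evaluation at u = 0.
section EvalZero

variable (𝔤 : Type*) [LieRing 𝔤] [LieAlgebra ℂ 𝔤]

/-- The evaluation `U(𝔤[u]) → U(𝔤)` at `u = 0`. -/
def envEval : EnvCurrent 𝔤 →ₐ[ℂ] UniversalEnvelopingAlgebra ℂ 𝔤 :=
  letI := LieRing.ofAssociativeRing (A := UniversalEnvelopingAlgebra ℂ 𝔤)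
  UniversalEnvelopingAlgebra.lift ℂ
    { envι 𝔤 ∘ₗ (TensorProduct.lid ℂ 𝔤).toLinearMap ∘ₗ
        (Polynomial.lcoeff ℂ 0).rTensor 𝔤 with
      map_lie' := by
        intro a b
        have h : ∀ a b : Current 𝔤, (TensorProduct.lid ℂ 𝔤).toLinearMap
            ((Polynomial.lcoeff ℂ 0).rTensor 𝔤 ⁅a, b⁆) =
              ⁅(TensorProduct.lid ℂ 𝔤).toLinearMap ((Polynomial.lcoeff ℂ 0).rTensor 𝔤 a),
                (TensorProduct.lid ℂ 𝔤).toLinearMap ((Polynomial.lcoeff ℂ 0).rTensor 𝔤 b)⁆ := by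
          intro a b
          induction a using TensorProduct.induction_on with
          | zero => rw [show ⁅(0 : Current 𝔤), b⁆ = 0 from zero_lie b]; simp
          | add a a' h h' =>
            rw [show ⁅(a + a' : Current 𝔤), b⁆ = ⁅a, b⁆ + ⁅a', b⁆ from add_lie a a' b]
            simp only [add_lie, map_add, h, h']
          | tmul p x =>
            induction b using TensorProduct.induction_on with
            | zero =>
              rw [show ⁅(p ⊗ₜ[ℂ] x : Current 𝔤), (0 : Current 𝔤)⁆ = 0 from
                lie_zero (p ⊗ₜ[ℂ] x : Current 𝔤)]
              simp
            | add b b' h h' =>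
              rw [show ⁅(p ⊗ₜ[ℂ] x : Current 𝔤), (b + b' : Current 𝔤)⁆ =
                ⁅p ⊗ₜ[ℂ] x, b⁆ + ⁅p ⊗ₜ[ℂ] x, b'⁆ from
                  lie_add (p ⊗ₜ[ℂ] x : Current 𝔤) b b']
              simp only [lie_add, map_add, h, h']
            | tmul q y =>
              simp [LieAlgebra.ExtendScalars.bracket_tmul, mul_coeff_zero, smul_smul, mul_comm]
        change envι 𝔤 _ = _
        rw [LinearMap.comp_apply, h, envι_lie]
        rfl }

variable {𝔤}

theorem envEval_ι (p : ℂ[X]) (x : 𝔤) :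
    envEval 𝔤 (envι (Current 𝔤) (p ⊗ₜ[ℂ] x)) = p.coeff 0 • envι 𝔤 x := by
  refine (UniversalEnvelopingAlgebra.lift_ι_apply ℂ _ _).trans ?_
  change envι 𝔤 _ = _
  simp

theorem envEval_monomial (n : ℕ) (x : 𝔤) :
    envEval 𝔤 (envMonomial n x) = if n = 0 then envι 𝔤 x else 0 := by
  rw [envMonomial, envEval_ι]
  rcases eq_or_ne n 0 with rfl | h
  · simp
  · simp [h, coeff_X_pow, h.symm]

/-- A product of total degree one has a factor of positive degree in u. -/
theorem envEval_eq_zero {y : EnvCurrent 𝔤} (hy : y ∈ envGrading 𝔤 1) : envEval 𝔤 y = 0 := by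
  induction hy using Submodule.span_induction with
  | mem y hy =>
    obtain ⟨l, hl, rfl⟩ := hy
    rw [map_list_prod, List.map_map]
    have : ∃ p ∈ l, p.1 ≠ 0 := by
      by_contra! h
      have : (l.map Prod.fst).sum = 0 := List.sum_eq_zero (by simpa using! h)
      omega
    obtain ⟨p, hp, h0⟩ := this
    apply List.prod_eq_zero
    rw [List.mem_map]
    exact ⟨p, hp, by simp [envEval_monomial, h0]⟩
  | zero => simp
  | add x y _ _ hx hy => rw [map_add, hx, hy, add_zero]
  | smul c x _ hx => rw [map_smul, hx, smul_zero]

theorem map_envEval_envComul (y : EnvCurrent 𝔤) :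
    TensorProduct.map (envEval 𝔤).toLinearMap (envEval 𝔤).toLinearMap
      (envComul (Current 𝔤) y) = envComul 𝔤 (envEval 𝔤 y) := by
  have : (Algebra.TensorProduct.map (envEval 𝔤) (envEval 𝔤)).comp (envComul (Current 𝔤)) =
      (envComul 𝔤).comp (envEval 𝔤) := by
    apply envAlgHom_ext
    intro z
    induction z using TensorProduct.induction_on with
    | zero => simp
    | add a b ha hb => rw [map_add, map_add, map_add, ha, hb]
    | tmul p x =>
      simp [envComul_ι, envEval_ι, TensorProduct.smul_tmul', TensorProduct.tmul_smul]
  exact DFunLike.congr_fun this y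

end EvalZero

/-! ### The tensor [x ⊗ 1, Ω]: antisymmetry, equivariance, cocycle property. -/

section Antisymmetry

variable {𝔤 : Type*} [LieRing 𝔤] [LieAlgebra ℂ 𝔤]

theorem lie_eq_bracketLeft_add_comm (x : 𝔤) (t : 𝔤 ⊗[ℂ] 𝔤) :
    ⁅x, t⁆ = bracketLeft t x +
      TensorProduct.comm ℂ 𝔤 𝔤 (bracketLeft (TensorProduct.comm ℂ 𝔤 𝔤 t) x) := by
  induction t using TensorProduct.induction_on with
  | zero => simp [bracketLeft]
  | tmul a b => simp [bracketLeft, TensorProduct.LieModule.lie_tmul_right]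
  | add s t hs ht =>
    rw [lie_add, hs, ht]
    simp only [bracketLeft, map_add, LinearMap.coe_mk, AddHom.coe_mk]
    abel

theorem lie_bracketLeft (x y : 𝔤) (t : 𝔤 ⊗[ℂ] 𝔤) :
    ⁅x, bracketLeft t y⁆ = bracketLeft t ⁅x, y⁆ + bracketLeft ⁅x, t⁆ y := by
  induction t using TensorProduct.induction_on with
  | zero => simp [bracketLeft]
  | tmul a b =>
    simp [bracketLeft, TensorProduct.LieModule.lie_tmul_right, lie_lie, TensorProduct.sub_tmul]
    abel
  | add s t hs ht =>
    simp only [bracketLeft, map_add, LinearMap.coe_mk, AddHom.coe_mk, lie_add] at hs ht ⊢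
    rw [hs, ht]
    abel

theorem cobarTwo_map_ι (t : 𝔤 ⊗[ℂ] 𝔤) :
    cobarTwo 𝔤 (TensorProduct.map (envι 𝔤) (envι 𝔤) t) = 0 := by
  induction t using TensorProduct.induction_on with
  | zero => simp
  | tmul a b => exact cobarTwo_ι_tmul_ι a b
  | add s t hs ht => rw [map_add, map_add, hs, ht, add_zero]

variable [FiniteDimensional ℂ 𝔤] {B : LinearMap.BilinForm ℂ 𝔤}

/-- Invariance of Ω gives [x ⊗ 1, Ω] = -[1 ⊗ x, Ω], and the flip exchanges the two brackets because
Ω is symmetric. -/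
theorem comm_bracketLeft_casimir (hB : B.Nondegenerate) (hsymm : B.IsSymm)
    (hinv : B.lieInvariant 𝔤) (x : 𝔤) :
    TensorProduct.comm ℂ 𝔤 𝔤 (bracketLeft (casimir B hB) x) = -bracketLeft (casimir B hB) x := by
  have h := lie_eq_bracketLeft_add_comm x (casimir B hB)
  rw [lie_casimir hB hinv, comm_casimir hB hsymm] at h
  exact (neg_eq_of_add_eq_zero_right h.symm).symm

theorem lie_bracketLeft_casimir (hB : B.Nondegenerate) (hinv : B.lieInvariant 𝔤) (x y : 𝔤) :
    ⁅x, bracketLeft (casimir B hB) y⁆ = bracketLeft (casimir B hB) ⁅x, y⁆ := by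
  rw [lie_bracketLeft, lie_casimir hB hinv]
  simp [bracketLeft]

/-- The cobracket of xu involves only u⁰v⁰, so evaluating at zero loses nothing. -/
theorem map_envEval_cobracket (hB : B.Nondegenerate) (x : 𝔤) :
    TensorProduct.map (envEval 𝔤).toLinearMap (envEval 𝔤).toLinearMap
      (TensorProduct.map (envι (Current 𝔤)) (envι (Current 𝔤))
        (cobracket B hB ((X ^ 1 : ℂ[X]) ⊗ₜ[ℂ] x))) =
      TensorProduct.map (envι 𝔤) (envι 𝔤) (bracketLeft (casimir B hB) x) := by
  have h : divDiff (X ^ 1 : ℂ[X]) = 1 ⊗ₜ 1 := by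
    have h1 : (X : ℂ[X]) ^ 1 = Polynomial.basisMonomials ℂ 1 := by
      simp [Polynomial.X]
    rw [h1, divDiff, Module.Basis.constr_basis]
    simp
  rw [cobracket, LinearMap.comp_apply, TensorProduct.map_tmul, h]
  generalize bracketLeft (casimir B hB) x = t
  induction t using TensorProduct.induction_on with
  | zero => simp
  | tmul a b => simp [envEval_ι]
  | add s t hs ht => simp only [TensorProduct.tmul_add, map_add, hs, ht]

end Antisymmetry
-- Compatibility of complex and polynomial scalars.
section ToTensor

variable {H : Type*} [Ring H] [Algebra ℂ H] [HopfAlgebra ℂ[X] H] [IsScalarTower ℂ ℂ[X] H]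

@[simp]
theorem toTensor_tmul (a b : H) : toTensor H (a ⊗ₜ[ℂ] b) = a ⊗ₜ[ℂ[X]] b := rfl

theorem C_smul_eq {M : Type*} [AddCommGroup M] [Module ℂ M] [Module ℂ[X] M]
    [IsScalarTower ℂ ℂ[X] M] (c : ℂ) (m : M) : (C c : ℂ[X]) • m = c • m := by
  rw [← Polynomial.algebraMap_eq, algebraMap_smul]

theorem C_mul_X_smul {M : Type*} [AddCommGroup M] [Module ℂ M] [Module ℂ[X] M]
    [IsScalarTower ℂ ℂ[X] M] (c : ℂ) (m : M) :
    (C c * X : ℂ[X]) • m = (X : ℂ[X]) • c • m := by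
  rw [mul_comm, mul_smul, C_smul_eq]

theorem specializeTensor_smul {A : Type*} [Ring A] [Algebra ℂ A] (π : H →ₐ[ℂ] A)
    (hπ : ∀ h : H, π ((X : ℂ[X]) • h) = 0) (c : ℂ) (t : H ⊗[ℂ[X]] H) :
    specializeTensor π hπ (c • t) = c • specializeTensor π hπ t := by
  induction t using TensorProduct.induction_on with
  | zero => simp
  | tmul a b =>
    rw [TensorProduct.smul_tmul', specializeTensor_tmul, specializeTensor_tmul, map_smul,
      TensorProduct.smul_tmul']
  | add s t hs ht => rw [smul_add, map_add, map_add, hs, ht, smul_add]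

end ToTensor

/-! ### The quantization and its tensor square in degrees zero and one. -/

namespace HomogeneousQuantization

variable {H : Type*} [Ring H] [Algebra ℂ H] [HopfAlgebra ℂ[X] H] [IsScalarTower ℂ ℂ[X] H]
variable {𝔤 : Type*} [LieRing 𝔤] [LieAlgebra ℂ 𝔤] [FiniteDimensional ℂ 𝔤]
variable {B : LinearMap.BilinForm ℂ 𝔤} {hB : B.Nondegenerate} (Q : HomogeneousQuantization H B hB)

local notation "U" => UniversalEnvelopingAlgebra ℂ 𝔤

theorem π_hbar_smul (h : H) : Q.π ((X : ℂ[X]) • h) = 0 := (Q.π_eq_zero_iff _).2 ⟨h, rfl⟩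

theorem π_smul (p : ℂ[X]) (h : H) : Q.π (p • h) = p.eval 0 • Q.π h := by
  conv_lhs => rw [← Polynomial.divX_mul_X_add p]
  rw [add_smul, mul_comm, mul_smul, map_add, Q.π_hbar_smul, zero_add, C_smul_eq, map_smul,
    coeff_zero_eq_eval_zero]

theorem hbar_smul_injective (Q : HomogeneousQuantization H B hB) {h h' : H}
    (e : (X : ℂ[X]) • h = (X : ℂ[X]) • h') : h = h' := by
  have := Q.torsionFree
  exact smul_right_injective H (X_ne_zero (R := ℂ)) e

/-- Torsion-free modules over the principal ideal domain ℂ[ħ] are flat, so their tensor products are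
again torsion free. -/
theorem hbar_smul_tensor_injective (Q : HomogeneousQuantization H B hB) {t t' : H ⊗[ℂ[X]] H}
    (e : (X : ℂ[X]) • t = (X : ℂ[X]) • t') :
    t = t' := by
  have := Q.torsionFree
  exact smul_right_injective _ (X_ne_zero (R := ℂ)) e

theorem hbar_smul_tensor_tensor_injective (Q : HomogeneousQuantization H B hB)
    {t t' : H ⊗[ℂ[X]] (H ⊗[ℂ[X]] H)}
    (e : (X : ℂ[X]) • t = (X : ℂ[X]) • t') : t = t' := by
  have := Q.torsionFree
  exact smul_right_injective _ (X_ne_zero (R := ℂ)) e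

/-! ### The degree zero part -/

theorem incl_lie (x y : 𝔤) : Q.incl ⁅x, y⁆ = Q.incl x * Q.incl y - Q.incl y * Q.incl x := by
  refine ((Q.existsUnique_lift ⁅x, y⁆).choose_spec.2 _ ⟨?_, ?_⟩).symm
  · exact sub_mem (Q.isGradedHopf.mul_mem 0 0 _ (Q.incl_mem x) _ (Q.incl_mem y))
      (Q.isGradedHopf.mul_mem 0 0 _ (Q.incl_mem y) _ (Q.incl_mem x))
  · rw [map_sub, map_mul, map_mul, π_incl, π_incl, envMonomial, envMonomial, ← envι_lie,
      envMonomial, LieAlgebra.ExtendScalars.bracket_tmul, ← pow_add]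

/-- The algebra homomorphism `U(𝔤) → H` that identifies `U(𝔤)` with `H₀`. -/
def envIncl : U →ₐ[ℂ] H :=
  letI := LieRing.ofAssociativeRing (A := H)
  UniversalEnvelopingAlgebra.lift ℂ
    { Q.incl with
      map_lie' := fun {x y} => Q.incl_lie x y }

theorem envIncl_ι (x : 𝔤) : Q.envIncl (envι 𝔤 x) = Q.incl x :=
  UniversalEnvelopingAlgebra.lift_ι_apply ℂ _ x

/-- The projection `H → U(𝔤)`, reduction modulo `ħ` followed by evaluation at `u = 0`. -/
def proj : H →ₐ[ℂ] U := (envEval 𝔤).comp Q.π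

theorem proj_apply (h : H) : Q.proj h = envEval 𝔤 (Q.π h) := rfl

@[simp]
theorem proj_envIncl (a : U) : Q.proj (Q.envIncl a) = a := by
  have : Q.proj.comp Q.envIncl = AlgHom.id ℂ U := by
    apply envAlgHom_ext
    intro x
    rw [AlgHom.comp_apply, envIncl_ι, proj_apply, π_incl, envEval_monomial, if_pos rfl]
    rfl
  exact DFunLike.congr_fun this a

theorem envIncl_mem (a : U) : Q.envIncl a ∈ Q.comp 0 := by
  induction a using env_induction with
  | algebraMap c =>
    rw [AlgHom.commutes, Algebra.algebraMap_eq_smul_one]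
    exact Submodule.smul_mem _ c Q.isGradedHopf.one_mem
  | ι x => rw [envIncl_ι]; exact Q.incl_mem x
  | mul a b ha hb => rw [map_mul]; exact Q.isGradedHopf.mul_mem 0 0 _ ha _ hb
  | add a b ha hb => rw [map_add]; exact add_mem ha hb

theorem π_envIncl_envEval {y : EnvCurrent 𝔤} (hy : y ∈ envGrading 𝔤 0) :
    Q.π (Q.envIncl (envEval 𝔤 y)) = y := by
  induction hy using Submodule.span_induction with
  | mem y hy =>
    obtain ⟨l, hl, rfl⟩ := hy
    induction l with
    | nil => simp
    | cons p l ih =>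
      rw [List.map_cons, List.sum_cons] at hl
      rw [List.map_cons, List.prod_cons, map_mul, map_mul, map_mul, ih (by omega),
        envEval_monomial, if_pos (by omega), envIncl_ι, π_incl, show p.1 = 0 by omega]
  | zero => simp
  | add x y _ _ hx hy => simp only [map_add, hx, hy]
  | smul c x _ hx => simp only [map_smul, hx]

theorem envIncl_proj {h : H} (hh : h ∈ Q.comp 0) : Q.envIncl (Q.proj h) = h := by
  refine sub_eq_zero.1 (Q.eq_zero_of_mem_zero _ (sub_mem (Q.envIncl_mem _) hh) ?_)
  rw [map_sub, proj_apply, Q.π_envIncl_envEval, sub_self]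
  rw [← Q.π_comp 0]
  exact ⟨h, hh, rfl⟩

theorem proj_eq_zero {h : H} (hh : h ∈ Q.comp 1) : Q.proj h = 0 := by
  apply envEval_eq_zero
  rw [← Q.π_comp 1]
  exact ⟨h, hh, rfl⟩

/-- Write h = ħh'. Since ħ raises degrees by one, only the degree zero component of h' matters, and
it lies in the copy of U(𝔤). -/
theorem exists_of_π_eq_zero {h : H} (hh : h ∈ Q.comp 1) (h0 : Q.π h = 0) :
    ∃ a : U, h = (X : ℂ[X]) • Q.envIncl a := by
  classical
  obtain ⟨h', rfl⟩ := (Q.π_eq_zero_iff h).1 h0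
  let _ : DirectSum.Decomposition Q.comp := Q.isGradedHopf.isInternal.chooseDecomposition
  have key : ∀ y : H, (DirectSum.decompose Q.comp ((X : ℂ[X]) • y) 1 : H) =
      (X : ℂ[X]) • (DirectSum.decompose Q.comp y 0 : H) := by
    intro y
    induction y using DirectSum.Decomposition.inductionOn Q.comp with
    | zero => simp
    | homogeneous m =>
      rename_i i
      have hm := Q.isGradedHopf.hbar_smul_mem i m m.2
      rcases eq_or_ne i 0 with rfl | hi
      · rw [DirectSum.decompose_of_mem_same Q.comp hm, DirectSum.decompose_of_mem_same Q.comp m.2]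
      · rw [DirectSum.decompose_of_mem_ne Q.comp hm (by omega),
          DirectSum.decompose_of_mem_ne Q.comp m.2 hi, smul_zero]
    | add m m' h1 h2 =>
      rw [smul_add, DirectSum.decompose_add, DirectSum.decompose_add]
      simp [h1, h2]
  refine ⟨Q.proj (DirectSum.decompose Q.comp h' 0 : H), ?_⟩
  rw [Q.envIncl_proj (SetLike.coe_mem _), ← key, DirectSum.decompose_of_mem_same Q.comp hh]

/-! ### The degree zero part of the tensor square -/

/-- The map `U(𝔤) ⊗ U(𝔤) → H ⊗ H`, an isomorphism onto the part of degree zero. -/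
def tensorIncl : U ⊗[ℂ] U →ₗ[ℂ] H ⊗[ℂ[X]] H :=
  toTensor H ∘ₗ TensorProduct.map Q.envIncl.toLinearMap Q.envIncl.toLinearMap

@[simp]
theorem tensorIncl_tmul (a b : U) :
    Q.tensorIncl (a ⊗ₜ b) = Q.envIncl a ⊗ₜ[ℂ[X]] Q.envIncl b := rfl

/-- The projection `H → U(𝔤)` as a semilinear map. -/
def projₛ : H →ₛₗ[Polynomial.evalRingHom (0 : ℂ)] U where
  toFun := Q.proj
  map_add' := map_add _
  map_smul' p h := by rw [proj_apply, π_smul, map_smul]; rfl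

/-- The projection `H ⊗ H → U(𝔤) ⊗ U(𝔤)`. -/
def tensorProj : H ⊗[ℂ[X]] H →ₛₗ[Polynomial.evalRingHom (0 : ℂ)] U ⊗[ℂ] U :=
  TensorProduct.map Q.projₛ Q.projₛ

@[simp]
theorem tensorProj_tmul (a b : H) :
    Q.tensorProj (a ⊗ₜ[ℂ[X]] b) = Q.proj a ⊗ₜ Q.proj b := rfl

theorem tensorProj_smul (c : ℂ) (t : H ⊗[ℂ[X]] H) :
    Q.tensorProj (c • t) = c • Q.tensorProj t := by
  rw [← C_smul_eq, LinearMap.map_smulₛₗ]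
  simp

@[simp]
theorem tensorProj_tensorIncl (s : U ⊗[ℂ] U) : Q.tensorProj (Q.tensorIncl s) = s := by
  induction s using TensorProduct.induction_on with
  | zero => simp
  | tmul a b => simp
  | add s t hs ht => rw [map_add, map_add, hs, ht]

theorem tensorIncl_tensorProj {t : H ⊗[ℂ[X]] H} (ht : t ∈ tensorGrading Q.comp 0) :
    Q.tensorIncl (Q.tensorProj t) = t := by
  induction ht using Submodule.span_induction with
  | mem t ht =>
    obtain ⟨i, j, hij, a, ha, b, hb, rfl⟩ := ht
    obtain ⟨rfl, rfl⟩ : i = 0 ∧ j = 0 := by omega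
    rw [tensorProj_tmul, tensorIncl_tmul, Q.envIncl_proj ha, Q.envIncl_proj hb]
  | zero => simp
  | add s t _ _ hs ht => rw [map_add, map_add, hs, ht]
  | smul c t _ ht => rw [tensorProj_smul, map_smul, ht]

/-- The reduction `H ⊗ H → U(𝔤[u]) ⊗ U(𝔤[u])` modulo `ħ`. -/
abbrev spec : H ⊗[ℂ[X]] H →+ EnvCurrent 𝔤 ⊗[ℂ] EnvCurrent 𝔤 :=
  specializeTensor Q.π Q.π_hbar_smul

theorem map_envEval_spec (t : H ⊗[ℂ[X]] H) :
    TensorProduct.map (envEval 𝔤).toLinearMap (envEval 𝔤).toLinearMap (Q.spec t) =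
      Q.tensorProj t := by
  induction t using TensorProduct.induction_on with
  | zero => simp
  | tmul a b => rfl
  | add s t hs ht => rw [map_add, map_add, map_add, hs, ht]

theorem tensorProj_comul (h : H) :
    Q.tensorProj (Coalgebra.comul (R := ℂ[X]) h) = envComul 𝔤 (Q.proj h) := by
  rw [← map_envEval_spec, spec, Q.π_comul, map_envEval_envComul]
  rfl

/-- Δ preserves degree, and degree zero tensors are determined by their reduction, so Δ has no
ħ-corrections on H₀. -/
theorem comul_envIncl (a : U) :
    Coalgebra.comul (R := ℂ[X]) (Q.envIncl a) = Q.tensorIncl (envComul 𝔤 a) := by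
  rw [← Q.tensorIncl_tensorProj (Q.isGradedHopf.comul_mem 0 _ (Q.envIncl_mem a)),
    tensorProj_comul, proj_envIncl]

theorem comul_incl (x : 𝔤) : Coalgebra.comul (R := ℂ[X]) (Q.incl x) =
    Q.incl x ⊗ₜ[ℂ[X]] (1 : H) + (1 : H) ⊗ₜ[ℂ[X]] Q.incl x := by
  rw [← envIncl_ι, comul_envIncl, envComul_ι, map_add, tensorIncl_tmul, tensorIncl_tmul, map_one]

/-! ### The degree one part of the tensor square -/

theorem exists_section : ∃ s : EnvCurrent 𝔤 →ₗ[ℂ] H, ∀ h ∈ Q.comp 1,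
    s (Q.π h) ∈ Q.comp 1 ∧ Q.π (s (Q.π h)) = Q.π h := by
  have hmem : ∀ h : Q.comp 1, Q.π h ∈ envGrading 𝔤 1 := fun h => by
    rw [← Q.π_comp 1]
    exact ⟨h, h.2, rfl⟩
  let f : Q.comp 1 →ₗ[ℂ] envGrading 𝔤 1 :=
    (Q.π.toLinearMap ∘ₗ (Q.comp 1).subtype).codRestrict _ hmem
  have hf : LinearMap.range f = ⊤ := by
    rw [LinearMap.range_eq_top]
    rintro ⟨y, hy⟩
    obtain ⟨h, hh, rfl⟩ := Q.π_comp 1 ▸ hy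
    exact ⟨⟨h, hh⟩, rfl⟩
  obtain ⟨g, hg⟩ := f.exists_rightInverse_of_surjective hf
  obtain ⟨s, hs⟩ := ((Q.comp 1).subtype ∘ₗ g).exists_extend
  refine ⟨s, fun h hh => ?_⟩
  have h1 : s (Q.π h) = g ⟨Q.π h, hmem ⟨h, hh⟩⟩ := LinearMap.congr_fun hs ⟨Q.π h, hmem ⟨h, hh⟩⟩
  refine ⟨h1 ▸ (g _).2, ?_⟩
  rw [h1]
  exact congrArg Subtype.val (LinearMap.congr_fun hg ⟨Q.π h, hmem ⟨h, hh⟩⟩)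

/-- A linear section of reduction on H₁, combined with the identification of H₀, gives a map Φ back
from the reduced tensors. It recovers a degree one tensor up to ħ times a degree zero tensor, so a
tensor with zero reduction is only that error. -/
theorem exists_of_spec_eq_zero {t : H ⊗[ℂ[X]] H} (ht : t ∈ tensorGrading Q.comp 1)
    (h0 : Q.spec t = 0) : ∃ s, t = (X : ℂ[X]) • Q.tensorIncl s := by
  obtain ⟨σ, hσ⟩ := Q.exists_section
  -- `q` inverts reduction in degree zero and kills degree one, so of the two summands of Φ exactly
  -- the one matching the bidegree survives.
  let q : EnvCurrent 𝔤 →ₗ[ℂ] H := Q.envIncl.toLinearMap ∘ₗ (envEval 𝔤).toLinearMap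
  let Φ : EnvCurrent 𝔤 ⊗[ℂ] EnvCurrent 𝔤 →ₗ[ℂ] H ⊗[ℂ[X]] H :=
    toTensor H ∘ₗ (TensorProduct.map σ q + TensorProduct.map q σ)
  have hq0 : ∀ h ∈ Q.comp 0, q (Q.π h) = h := fun h hh => Q.envIncl_proj hh
  have hq1 : ∀ h ∈ Q.comp 1, q (Q.π h) = 0 := fun h hh => by
    change Q.envIncl (Q.proj h) = 0
    rw [Q.proj_eq_zero hh, map_zero]
  have hσ' : ∀ h ∈ Q.comp 1, ∃ a, h = (X : ℂ[X]) • Q.envIncl a + σ (Q.π h) := fun h hh => by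
    obtain ⟨a, ha⟩ := Q.exists_of_π_eq_zero (sub_mem hh (hσ h hh).1)
      (by rw [map_sub, (hσ h hh).2, sub_self])
    exact ⟨a, by rw [← ha, sub_add_cancel]⟩
  have hΦ : ∀ a b : H, Φ (Q.π a ⊗ₜ Q.π b) =
      σ (Q.π a) ⊗ₜ[ℂ[X]] q (Q.π b) + q (Q.π a) ⊗ₜ[ℂ[X]] σ (Q.π b) := fun a b => by
    simp [Φ]
  have key : ∃ s, t = (X : ℂ[X]) • Q.tensorIncl s + Φ (Q.spec t) := by
    clear h0
    induction ht using Submodule.span_induction with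
    | mem t ht =>
      obtain ⟨i, j, hij, a, ha, b, hb, rfl⟩ := ht
      rw [spec, specializeTensor_tmul, hΦ]
      obtain ⟨rfl, rfl⟩ | ⟨rfl, rfl⟩ : (i = 0 ∧ j = 1) ∨ (i = 1 ∧ j = 0) := by omega
      · rw [hq0 a ha, hq1 b hb, TensorProduct.tmul_zero, zero_add]
        obtain ⟨c, hc⟩ := hσ' b hb
        refine ⟨Q.proj a ⊗ₜ c, ?_⟩
        conv_lhs => rw [hc]
        rw [tensorIncl_tmul, Q.envIncl_proj ha, TensorProduct.tmul_add, TensorProduct.tmul_smul]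
      · rw [hq1 a ha, hq0 b hb, TensorProduct.zero_tmul, add_zero]
        obtain ⟨c, hc⟩ := hσ' a ha
        refine ⟨c ⊗ₜ Q.proj b, ?_⟩
        conv_lhs => rw [hc]
        rw [tensorIncl_tmul, Q.envIncl_proj hb, TensorProduct.add_tmul, TensorProduct.smul_tmul']
    | zero => exact ⟨0, by simp⟩
    | add s t _ _ hs ht =>
      obtain ⟨a, ha⟩ := hs
      obtain ⟨b, hb⟩ := ht
      refine ⟨a + b, ?_⟩
      conv_lhs => rw [ha, hb]
      simp only [map_add, smul_add]
      abel
    | smul c t _ ht =>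
      obtain ⟨a, ha⟩ := ht
      refine ⟨c • a, ?_⟩
      conv_lhs => rw [ha]
      rw [spec, specializeTensor_smul, map_smul, map_smul, smul_add, smul_comm c]
  obtain ⟨s, hs⟩ := key
  exact ⟨s, by rw [hs, h0, map_zero, add_zero]⟩

end HomogeneousQuantization
-- The adjoint representation factors through U(L) and is faithful because the center vanishes; PBW
-- is not needed.
theorem ι_injective {L : Type*} [LieRing L] [LieAlgebra ℂ L] [LieAlgebra.IsSimple ℂ L] :
    Function.Injective (envι L) := by
  rw [← LinearMap.ker_eq_bot, eq_bot_iff]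
  intro x hx
  let _ := LieRing.ofAssociativeRing (A := Module.End ℂ L)
  have h : UniversalEnvelopingAlgebra.lift ℂ (LieAlgebra.ad ℂ L) (envι L x) =
      LieAlgebra.ad ℂ L x := UniversalEnvelopingAlgebra.lift_ι_apply ℂ _ x
  rw [LinearMap.mem_ker.1 hx, map_zero] at h
  have hc : x ∈ (LieAlgebra.ad ℂ L).ker := h.symm
  simpa using hc

/-! ### Lifts of xu with the required coproduct. -/

namespace HomogeneousQuantization

variable {H : Type*} [Ring H] [Algebra ℂ H] [HopfAlgebra ℂ[X] H] [IsScalarTower ℂ ℂ[X] H]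
variable {𝔤 : Type*} [LieRing 𝔤] [LieAlgebra ℂ 𝔤] [FiniteDimensional ℂ 𝔤]
variable {B : LinearMap.BilinForm ℂ 𝔤} {hB : B.Nondegenerate} (Q : HomogeneousQuantization H B hB)

local notation "U" => UniversalEnvelopingAlgebra ℂ 𝔤

/-- The embedding `𝔤 ⊗ 𝔤 → H ⊗ H`. -/
def pairIncl : 𝔤 ⊗[ℂ] 𝔤 →ₗ[ℂ] H ⊗[ℂ[X]] H := toTensor H ∘ₗ TensorProduct.map Q.incl Q.incl

theorem pairIncl_tmul (a b : 𝔤) : Q.pairIncl (a ⊗ₜ b) = Q.incl a ⊗ₜ[ℂ[X]] Q.incl b := rfl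

theorem tensorIncl_map_ι (t : 𝔤 ⊗[ℂ] 𝔤) :
    Q.tensorIncl (TensorProduct.map (envι 𝔤) (envι 𝔤) t) = Q.pairIncl t := by
  induction t using TensorProduct.induction_on with
  | zero => simp
  | tmul a b => simp [pairIncl_tmul, envIncl_ι]
  | add s t hs ht => simp only [map_add, hs, ht]

theorem bracket_pairIncl (x : 𝔤) (t : 𝔤 ⊗[ℂ] 𝔤) :
    (Q.incl x ⊗ₜ[ℂ[X]] (1 : H)) * Q.pairIncl t - Q.pairIncl t * (Q.incl x ⊗ₜ[ℂ[X]] (1 : H)) =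
      Q.pairIncl (bracketLeft t x) := by
  induction t using TensorProduct.induction_on with
  | zero => simp [bracketLeft]
  | tmul a b =>
    have : bracketLeft (a ⊗ₜ[ℂ] b) x = ⁅x, a⁆ ⊗ₜ b := by simp [bracketLeft]
    rw [this, pairIncl_tmul, pairIncl_tmul, incl_lie, Algebra.TensorProduct.tmul_mul_tmul,
      Algebra.TensorProduct.tmul_mul_tmul, TensorProduct.sub_tmul, one_mul, mul_one]
  | add s t hs ht =>
    have : bracketLeft (s + t) x = bracketLeft s x + bracketLeft t x := by simp [bracketLeft]
    rw [this, map_add, map_add, ← hs, ← ht, mul_add, add_mul]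
    abel

theorem bracket_comul_pairIncl (x : 𝔤) (t : 𝔤 ⊗[ℂ] 𝔤) :
    Coalgebra.comul (R := ℂ[X]) (Q.incl x) * Q.pairIncl t -
      Q.pairIncl t * Coalgebra.comul (R := ℂ[X]) (Q.incl x) = Q.pairIncl ⁅x, t⁆ := by
  induction t using TensorProduct.induction_on with
  | zero => simp
  | tmul a b =>
    rw [comul_incl, TensorProduct.LieModule.lie_tmul_right, map_add, pairIncl_tmul, pairIncl_tmul,
      pairIncl_tmul, incl_lie, incl_lie]
    simp only [add_mul, mul_add, Algebra.TensorProduct.tmul_mul_tmul, TensorProduct.sub_tmul,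
      TensorProduct.tmul_sub, one_mul, mul_one]
    abel
  | add s t hs ht =>
    rw [lie_add, map_add, map_add, ← hs, ← ht, mul_add, add_mul]
    abel

/-- The tensor `[x ⊗ 1, Ω]` in `H ⊗ H`. -/
def bracketΩ : 𝔤 →ₗ[ℂ] H ⊗[ℂ[X]] H := Q.pairIncl ∘ₗ bracketLeft (casimir B hB)

theorem bracketΩ_apply (x : 𝔤) : Q.bracketΩ x =
    (Q.incl x ⊗ₜ[ℂ[X]] (1 : H)) * Q.Ω - Q.Ω * (Q.incl x ⊗ₜ[ℂ[X]] (1 : H)) :=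
  (Q.bracket_pairIncl x _).symm

/-- The condition `Δ(h) = h ⊗ 1 + 1 ⊗ h + (ħ / 2) [x ⊗ 1, Ω]`. -/
def HasYangianComul (x : 𝔤) (h : H) : Prop :=
  Coalgebra.comul (R := ℂ[X]) h =
    h ⊗ₜ[ℂ[X]] (1 : H) + (1 : H) ⊗ₜ[ℂ[X]] h + (X : ℂ[X]) • (1 / 2 : ℂ) • Q.bracketΩ x

theorem hasYangianComul_iff (x : 𝔤) (h : H) : Q.HasYangianComul x h ↔
    Coalgebra.comul (R := ℂ[X]) h = h ⊗ₜ[ℂ[X]] (1 : H) + (1 : H) ⊗ₜ[ℂ[X]] h +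
      (C (1 / 2) * X : ℂ[X]) •
        ((Q.incl x ⊗ₜ[ℂ[X]] (1 : H)) * Q.Ω - Q.Ω * (Q.incl x ⊗ₜ[ℂ[X]] (1 : H))) := by
  rw [HasYangianComul, C_mul_X_smul, bracketΩ_apply]

variable {Q} in
theorem HasYangianComul.add {x y : 𝔤} {h k : H} (hx : Q.HasYangianComul x h)
    (hy : Q.HasYangianComul y k) : Q.HasYangianComul (x + y) (h + k) := by
  rw [HasYangianComul] at *
  rw [map_add, map_add, hx, hy, TensorProduct.add_tmul, TensorProduct.tmul_add, smul_add, smul_add]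
  abel

variable {Q} in
theorem HasYangianComul.smul (c : ℂ) {x : 𝔤} {h : H} (hx : Q.HasYangianComul x h) :
    Q.HasYangianComul (c • x) (c • h) := by
  rw [HasYangianComul] at *
  rw [LinearMap.map_smul_of_tower, map_smul, hx, smul_add, smul_add, TensorProduct.smul_tmul',
    ← smul_tmul_aux, TensorProduct.smul_tmul', smul_comm c (X : ℂ[X]), smul_comm c (1 / 2 : ℂ)]

variable {Q} in
theorem HasYangianComul.sub {x y : 𝔤} {h k : H} (hx : Q.HasYangianComul x h)
    (hy : Q.HasYangianComul y k) : Q.HasYangianComul (x - y) (h - k) := by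
  rw [sub_eq_add_neg, sub_eq_add_neg, ← neg_one_smul ℂ y, ← neg_one_smul ℂ k]
  exact hx.add (hy.smul (-1))

theorem hasYangianComul_hbar_smul_incl (y : 𝔤) : Q.HasYangianComul 0 ((X : ℂ[X]) • Q.incl y) := by
  rw [HasYangianComul, map_smul, comul_incl]
  simp [TensorProduct.smul_tmul']

/-- By coassociativity, the failure of an element to be primitive is a cocycle. -/
theorem cobarTwo_eq_zero {h : H} {s : U ⊗[ℂ] U}
    (hs : Coalgebra.comul (R := ℂ[X]) h =
      h ⊗ₜ[ℂ[X]] (1 : H) + (1 : H) ⊗ₜ[ℂ[X]] h + (X : ℂ[X]) • Q.tensorIncl s) :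
    cobarTwo 𝔤 s = 0 := by
  have hco := Coalgebra.coassoc_apply (R := ℂ[X]) h
  rw [hs] at hco
  let δ : H →ₗ[ℂ[X]] H ⊗[ℂ[X]] H := Coalgebra.comul
  let t := Q.tensorIncl s
  -- Coassociativity for `h`: the terms linear in `h` cancel, and the common factor ħ can be divided
  -- out.
  have key : (1 : H) ⊗ₜ[ℂ[X]] t + δ.lTensor H t =
      TensorProduct.assoc ℂ[X] H H H (t ⊗ₜ (1 : H)) +
        TensorProduct.assoc ℂ[X] H H H (δ.rTensor H t) := by
    apply Q.hbar_smul_tensor_tensor_injective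
    simp only [map_add, LinearMap.rTensor_tmul, LinearMap.lTensor_tmul, Bialgebra.comul_one, hs,
      map_smul, TensorProduct.add_tmul, TensorProduct.tmul_add, TensorProduct.assoc_tmul,
      Algebra.TensorProduct.one_def, ← TensorProduct.smul_tmul', TensorProduct.tmul_smul] at hco
    rw [smul_add, smul_add]
    refine sub_eq_zero.1 ?_
    rw [← sub_eq_zero] at hco
    rw [← neg_eq_zero, ← hco]
    simp only [t, δ]
    abel
  -- Reduction modulo ħ followed by u = 0 in all three factors turns the divided identity into the
  -- cocycle equation.
  let R : H ⊗[ℂ[X]] (H ⊗[ℂ[X]] H) →ₛₗ[Polynomial.evalRingHom (0 : ℂ)] U ⊗[ℂ] (U ⊗[ℂ] U) :=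
    TensorProduct.map Q.projₛ Q.tensorProj
  have hR : ∀ (a : H) (t : H ⊗[ℂ[X]] H), R (a ⊗ₜ t) = Q.proj a ⊗ₜ Q.tensorProj t :=
    fun _ _ => rfl
  have hR' : ∀ (t : H ⊗[ℂ[X]] H) (c : H), R (TensorProduct.assoc ℂ[X] H H H (t ⊗ₜ c)) =
      TensorProduct.assoc ℂ U U U (Q.tensorProj t ⊗ₜ Q.proj c) := by
    intro t c
    induction t using TensorProduct.induction_on with
    | zero => simp
    | tmul a b => rfl
    | add s t hs ht => simp only [TensorProduct.add_tmul, map_add, hs, ht]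
  have h1 : ∀ s : U ⊗[ℂ] U,
      R (δ.lTensor H (Q.tensorIncl s)) = (envComul 𝔤).toLinearMap.lTensor U s := by
    intro s
    induction s using TensorProduct.induction_on with
    | zero => simp
    | tmul a b => simp [hR, δ, tensorProj_comul]
    | add s t hs ht => simp only [map_add, hs, ht]
  have h2 : ∀ s : U ⊗[ℂ] U, R (TensorProduct.assoc ℂ[X] H H H (δ.rTensor H (Q.tensorIncl s))) =
      TensorProduct.assoc ℂ U U U ((envComul 𝔤).toLinearMap.rTensor U s) := by
    intro s
    induction s using TensorProduct.induction_on with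
    | zero => simp
    | tmul a b => simp [hR', δ, tensorProj_comul]
    | add s t hs ht => simp only [map_add, hs, ht]
  have hfin := congrArg R key
  rw [map_add, map_add, hR, hR', h1, h2, tensorProj_tensorIncl, map_one] at hfin
  rw [cobarTwo_apply, hfin, sub_self]

/-- Every `x u` has a lift to `H₁` with the required coproduct. -/
theorem exists_lift (hsymm : B.IsSymm) (hinv : B.lieInvariant 𝔤) (x : 𝔤) :
    ∃ h ∈ Q.comp 1, Q.π h = envMonomial 1 x ∧ Q.HasYangianComul x h := by
  have hx : envMonomial 1 x ∈ envGrading 𝔤 1 :=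
    Submodule.subset_span ⟨[(1, x)], by simp, by simp⟩
  rw [← Q.π_comp 1] at hx
  obtain ⟨h, hh, e⟩ := hx
  replace e : Q.π h = envMonomial 1 x := e
  obtain ⟨s, hs⟩ : ∃ s, Coalgebra.comul (R := ℂ[X]) h - (h ⊗ₜ[ℂ[X]] (1 : H) +
      (1 : H) ⊗ₜ[ℂ[X]] h) = (X : ℂ[X]) • Q.tensorIncl s := by
    apply Q.exists_of_spec_eq_zero
    · refine sub_mem (Q.isGradedHopf.comul_mem 1 h hh) (add_mem ?_ ?_)
      · exact Submodule.subset_span ⟨1, 0, rfl, h, hh, 1, Q.isGradedHopf.one_mem, rfl⟩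
      · exact Submodule.subset_span ⟨0, 1, rfl, 1, Q.isGradedHopf.one_mem, h, hh, rfl⟩
    · rw [map_sub, map_add, spec, Q.π_comul, specializeTensor_tmul, specializeTensor_tmul, e,
        map_one, envMonomial, envComul_ι, sub_self]
  rw [sub_eq_iff_eq_add'] at hs
  set D := TensorProduct.map (envι 𝔤) (envι 𝔤) (bracketLeft (casimir B hB) x) with hD
  have hcomm : ∀ t : 𝔤 ⊗[ℂ] 𝔤, TensorProduct.comm ℂ U U (TensorProduct.map (envι 𝔤) (envι 𝔤) t) =
      TensorProduct.map (envι 𝔤) (envι 𝔤) (TensorProduct.comm ℂ 𝔤 𝔤 t) := by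
    intro t
    induction t using TensorProduct.induction_on with
    | zero => simp
    | tmul a b => simp
    | add s t hs ht => simp only [map_add, hs, ht]
  have hDc : TensorProduct.comm ℂ U U D = -D := by
    rw [hD, hcomm, comm_bracketLeft_casimir hB hsymm hinv, map_neg]
  have hcommI : ∀ s : U ⊗[ℂ] U, TensorProduct.comm ℂ[X] H H (Q.tensorIncl s) =
      Q.tensorIncl (TensorProduct.comm ℂ U U s) := by
    intro s
    induction s using TensorProduct.induction_on with
    | zero => simp
    | tmul a b => simp
    | add s t hs ht => simp only [map_add, hs, ht]
  -- The quantization condition fixes the antisymmetric part of `s`; what remains after removing D/2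
  -- is symmetric.
  have hanti : s - TensorProduct.comm ℂ U U s = D := by
    obtain ⟨t, ht, ht'⟩ := Q.comul_sub_comul_op ((X ^ 1 : ℂ[X]) ⊗ₜ[ℂ] x) h e
    have h1 : t = Q.tensorIncl (s - TensorProduct.comm ℂ U U s) := by
      apply Q.hbar_smul_tensor_injective
      rw [← ht, hs]
      simp only [map_add, map_sub, map_smul, TensorProduct.comm_tmul, hcommI, smul_sub]
      abel
    have h2 := Q.map_envEval_spec t
    rw [spec, ht', map_envEval_cobracket, h1, tensorProj_tensorIncl] at h2
    exact h2.symm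
  obtain ⟨w, hw⟩ : ∃ w, s - (1 / 2 : ℂ) • D = cobarOne 𝔤 w := by
    apply exists_eq_cobarOne
    · rw [map_sub, map_smul, Q.cobarTwo_eq_zero hs, hD, cobarTwo_map_ι, smul_zero, sub_zero]
    · rw [map_sub, map_smul, hDc, ← hanti]
      module
  -- Subtracting ħw leaves the reduction unchanged and removes the coboundary dw from the coproduct
  -- defect.
  refine ⟨h - (X : ℂ[X]) • Q.envIncl w,
    sub_mem hh (Q.isGradedHopf.hbar_smul_mem 0 _ (Q.envIncl_mem w)), ?_, ?_⟩
  · rw [map_sub, π_hbar_smul, sub_zero, e]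
  · have h1 : s = cobarOne 𝔤 w + (1 / 2 : ℂ) • D := by rw [← hw, sub_add_cancel]
    rw [HasYangianComul, map_sub, map_smul, hs, comul_envIncl, h1, cobarOne_apply, map_add,
      map_smul, hD, tensorIncl_map_ι]
    simp only [map_sub, tensorIncl_tmul, map_one, smul_add, smul_sub, TensorProduct.sub_tmul,
      TensorProduct.tmul_sub, ← TensorProduct.smul_tmul', TensorProduct.tmul_smul]
    rw [bracketΩ, LinearMap.comp_apply]
    abel

/-- The primitive elements of degree one that vanish modulo `ħ`. -/
theorem exists_eq_hbar_smul_incl {h : H} (hh : h ∈ Q.comp 1) (h0 : Q.π h = 0)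
    (hc : Q.HasYangianComul 0 h) : ∃ y, h = (X : ℂ[X]) • Q.incl y := by
  obtain ⟨a, rfl⟩ := Q.exists_of_π_eq_zero hh h0
  obtain ⟨y, rfl⟩ : ∃ y, envι 𝔤 y = a := by
    apply exists_ι_of_primitive
    have h1 : Q.tensorIncl (envComul 𝔤 a) = Q.tensorIncl (a ⊗ₜ 1 + 1 ⊗ₜ a) := by
      apply Q.hbar_smul_tensor_injective
      rw [HasYangianComul, map_smul, comul_envIncl, map_zero, smul_zero, smul_zero, add_zero] at hc
      rw [hc, map_add, tensorIncl_tmul, tensorIncl_tmul, map_one, smul_add,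
        TensorProduct.smul_tmul', TensorProduct.tmul_smul]
    have h2 := congrArg Q.tensorProj h1
    rwa [tensorProj_tensorIncl, tensorProj_tensorIncl] at h2
  exact ⟨y, by rw [envIncl_ι]⟩

/-- The embedding `x ↦ ħ x` of `𝔤` into `H₁`. -/
def hbarIncl : 𝔤 →ₗ[ℂ] H := (LinearMap.lsmul ℂ[X] H X).restrictScalars ℂ ∘ₗ Q.incl

theorem hbarIncl_injective [LieAlgebra.IsSimple ℂ 𝔤] : Function.Injective Q.hbarIncl := by
  intro x y h
  have h1 := congrArg Q.proj (Q.hbar_smul_injective h)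
  rw [← envIncl_ι, ← envIncl_ι, proj_envIncl, proj_envIncl] at h1
  exact ι_injective h1

/-- Both conditions are linear in the pair (x, h), so the admissible pairs form a subspace that
surjects onto 𝔤; a linear section gives J. -/
theorem exists_linear_lift (hsymm : B.IsSymm) (hinv : B.lieInvariant 𝔤) :
    ∃ J : 𝔤 →ₗ[ℂ] Q.comp 1,
      ∀ x, Q.π (J x) = envMonomial 1 x ∧ Q.HasYangianComul x (J x) := by
  have hadd : ∀ x y : 𝔤, envMonomial 1 (x + y) = envMonomial 1 x + envMonomial 1 y := fun x y => by
    simp only [envMonomial, TensorProduct.tmul_add, map_add]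
  have hsmul : ∀ (c : ℂ) (x : 𝔤), envMonomial 1 (c • x) = c • envMonomial 1 x := fun c x => by
    simp only [envMonomial, TensorProduct.tmul_smul, map_smul]
  let V : Submodule ℂ (𝔤 × Q.comp 1) :=
    { carrier := {p | Q.π p.2 = envMonomial 1 p.1 ∧ Q.HasYangianComul p.1 p.2}
      zero_mem' := by
        refine ⟨?_, ?_⟩
        · simp [envMonomial]
        · simpa using! Q.hasYangianComul_hbar_smul_incl 0
      add_mem' := fun {p q} hp hq => ⟨by
        change Q.π ((p.2 : H) + q.2) = envMonomial 1 (p.1 + q.1)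
        rw [map_add, hp.1, hq.1, hadd], hp.2.add hq.2⟩
      smul_mem' := fun c p hp => ⟨by
        change Q.π (c • (p.2 : H)) = envMonomial 1 (c • p.1)
        rw [map_smul, hp.1, hsmul], hp.2.smul c⟩ }
  have hV : LinearMap.range (LinearMap.fst ℂ 𝔤 (Q.comp 1) ∘ₗ V.subtype) = ⊤ := by
    rw [LinearMap.range_eq_top]
    intro x
    obtain ⟨h, hh, h1, h2⟩ := Q.exists_lift hsymm hinv x
    exact ⟨⟨(x, ⟨h, hh⟩), h1, h2⟩, rfl⟩
  obtain ⟨g, hg⟩ := LinearMap.exists_rightInverse_of_surjective _ hV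
  refine ⟨LinearMap.snd ℂ 𝔤 (Q.comp 1) ∘ₗ V.subtype ∘ₗ g, fun x => ?_⟩
  have h1 : (g x : 𝔤 × Q.comp 1).1 = x := LinearMap.congr_fun hg x
  have h2 : Q.π (g x : 𝔤 × Q.comp 1).2 = envMonomial 1 (g x : 𝔤 × Q.comp 1).1 ∧
      Q.HasYangianComul (g x : 𝔤 × Q.comp 1).1 (g x : 𝔤 × Q.comp 1).2 := (g x).2
  rw [h1] at h2
  exact h2

/-- Δ is multiplicative, x is primitive, and y ↦ [y ⊗ 1, Ω] is equivariant. -/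
theorem hasYangianComul_commutator (hinv : B.lieInvariant 𝔤) (x : 𝔤) {y : 𝔤} {h : H}
    (hy : Q.HasYangianComul y h) :
    Q.HasYangianComul ⁅x, y⁆ (Q.incl x * h - h * Q.incl x) := by
  have hb : Coalgebra.comul (R := ℂ[X]) (Q.incl x) * Q.bracketΩ y -
      Q.bracketΩ y * Coalgebra.comul (R := ℂ[X]) (Q.incl x) = Q.bracketΩ ⁅x, y⁆ := by
    rw [bracketΩ, LinearMap.comp_apply, bracket_comul_pairIncl, lie_bracketLeft_casimir hB hinv]
    rfl
  rw [HasYangianComul] at *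
  rw [map_sub, Bialgebra.comul_mul, Bialgebra.comul_mul, hy, ← hb]
  simp only [mul_add, add_mul, mul_smul_comm, smul_mul_assoc, smul_sub, comul_incl,
    Algebra.TensorProduct.tmul_mul_tmul, one_mul, mul_one, TensorProduct.sub_tmul,
    TensorProduct.tmul_sub]
  simp only [smul_add]
  abel

theorem π_commutator (x : 𝔤) {y : 𝔤} {h : H} (hy : Q.π h = envMonomial 1 y) :
    Q.π (Q.incl x * h - h * Q.incl x) = envMonomial 1 ⁅x, y⁆ := by
  rw [map_sub, map_mul, map_mul, π_incl, hy, envMonomial, envMonomial, ← envι_lie,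
    LieAlgebra.ExtendScalars.bracket_tmul, ← pow_add]
  rfl

theorem commutator_incl_mem (x : 𝔤) {h : H} (hh : h ∈ Q.comp 1) :
    Q.incl x * h - h * Q.incl x ∈ Q.comp 1 :=
  sub_mem (Q.isGradedHopf.mul_mem 0 1 _ (Q.incl_mem x) _ hh)
    (Q.isGradedHopf.mul_mem 1 0 _ hh _ (Q.incl_mem x))

/-! ### Equivariance and uniqueness. -/

variable [LieAlgebra.IsSimple ℂ 𝔤]

theorem exists_isDegreeOneLift (hsymm : B.IsSymm) (hinv : B.lieInvariant 𝔤) :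
    ∃ J : 𝔤 →ₗ[ℂ] Q.comp 1, Q.IsDegreeOneLift J := by
  obtain ⟨J, hJ⟩ := Q.exists_linear_lift hsymm hinv
  let j : 𝔤 →ₗ[ℂ] H := (Q.comp 1).subtype ∘ₗ J
  have hj : ∀ x, j x ∈ Q.comp 1 ∧ Q.π (j x) = envMonomial 1 x ∧ Q.HasYangianComul x (j x) :=
    fun x => ⟨(J x).2, hJ x⟩
  let i := Q.hbarIncl
  have hi : ∀ x, i x = (X : ℂ[X]) • Q.incl x := fun _ => rfl
  have hiinj : Function.Injective i := Q.hbarIncl_injective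
  -- The defect lies in ħ𝔤; a linear retraction onto 𝔤 makes its coefficient `f` bilinear by
  -- construction.
  obtain ⟨l, hl⟩ := i.exists_leftInverse_of_injective (LinearMap.ker_eq_bot.2 hiinj)
  let D : 𝔤 →ₗ[ℂ] 𝔤 →ₗ[ℂ] H :=
    (LinearMap.mul ℂ H - (LinearMap.mul ℂ H).flip).compl₁₂ Q.incl j -
      (LieModule.toEnd ℂ 𝔤 𝔤 : 𝔤 →ₗ[ℂ] Module.End ℂ 𝔤).compr₂ j
  have hD : ∀ x y, D x y = Q.incl x * j y - j y * Q.incl x - j ⁅x, y⁆ := fun x y => by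
    simp [D]
  let f : 𝔤 →ₗ[ℂ] 𝔤 →ₗ[ℂ] 𝔤 := D.compr₂ l
  have hf : ∀ x y, Q.incl x * j y - j y * Q.incl x = j ⁅x, y⁆ + i (f x y) := by
    intro x y
    obtain ⟨z, hz⟩ : ∃ z, D x y = (X : ℂ[X]) • Q.incl z := by
      rw [hD]
      apply Q.exists_eq_hbar_smul_incl
      · exact sub_mem (Q.commutator_incl_mem x (hj y).1) (hj _).1
      · rw [map_sub, Q.π_commutator x (hj y).2.1, (hj _).2.1, sub_self]
      · simpa using (Q.hasYangianComul_commutator hinv x (hj y).2.2).sub (hj ⁅x, y⁆).2.2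
    have h1 : f x y = z := by
      change l (D x y) = z
      rw [hz, ← hi]
      exact LinearMap.congr_fun hl z
    rw [h1, hi, ← hz, hD]
    abel
  have hii : ∀ x y, Q.incl x * i y - i y * Q.incl x = i ⁅x, y⁆ := fun x y => by
    rw [hi, hi, incl_lie, mul_smul_comm, smul_mul_assoc, smul_sub]
  -- Whitehead's lemma with coefficients in End 𝔤. The cocycle identity follows from the Jacobi
  -- identity for commutators in H, after embedding by ħ.
  obtain ⟨φ, hφ⟩ := exists_eq_lie f (fun x y => by
    ext z
    simp only [LinearMap.sub_apply, LieHom.lie_apply]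
    apply hiinj
    have e1 := hf x z
    have e2 := hf y z
    have e3 := hf ⁅x, y⁆ z
    have e4 := hf x ⁅y, z⁆
    have e5 := hf y ⁅x, z⁆
    rw [lie_lie, map_sub, incl_lie] at e3
    rw [map_sub, map_sub, map_sub, ← hii, ← hii]
    have e1' : i (f x z) = Q.incl x * j z - j z * Q.incl x - j ⁅x, z⁆ := by rw [e1]; abel
    have e2' : i (f y z) = Q.incl y * j z - j z * Q.incl y - j ⁅y, z⁆ := by rw [e2]; abel
    have e3' := eq_sub_of_add_eq' e3.symm
    have e4' := eq_sub_of_add_eq' e4.symm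
    have e5' := eq_sub_of_add_eq' e5.symm
    rw [e1', e2', e3', e4', e5']
    noncomm_ring)
  have hmem : ∀ x, j x - i (φ x) ∈ Q.comp 1 := fun x =>
    sub_mem (hj x).1 (Q.isGradedHopf.hbar_smul_mem 0 _ (Q.incl_mem _))
  refine ⟨(j - i ∘ₗ φ).codRestrict _ hmem, ⟨fun x y => ?_, fun x => ?_, fun x => ?_⟩⟩
  · change j ⁅x, y⁆ - i (φ ⁅x, y⁆) =
      Q.incl x * (j y - i (φ y)) - (j y - i (φ y)) * Q.incl x
    have h1 : f x y = ⁅x, φ y⁆ - φ ⁅x, y⁆ := by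
      rw [hφ x, LieHom.lie_apply]
    have h2 := hf x y
    rw [h1, map_sub, ← hii] at h2
    have h3 : j ⁅x, y⁆ = Q.incl x * j y - j y * Q.incl x -
      (Q.incl x * i (φ y) - i (φ y) * Q.incl x - i (φ ⁅x, y⁆)) := by rw [h2]; abel
    rw [h3]
    noncomm_ring
  · change Q.π (j x - i (φ x)) = _
    rw [map_sub, (hj x).2.1, hi, π_hbar_smul, sub_zero]
  · rw [← hasYangianComul_iff]
    simpa using! (hj x).2.2.sub (Q.hasYangianComul_hbar_smul_incl (φ x))

/-- The terms ½ħ[x ⊗ 1, Ω] cancel, so the difference is primitive and zero modulo ħ, hence ħφ(x);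
equivariance of φ and Schur's lemma finish. -/
theorem exists_sub_eq_smul {J J' : 𝔤 →ₗ[ℂ] Q.comp 1} (hJ : Q.IsDegreeOneLift J)
    (hJ' : Q.IsDegreeOneLift J') :
    ∃ c : ℂ, ∀ x : 𝔤, (J x : H) - (J' x : H) = (C c * X : ℂ[X]) • Q.incl x := by
  let i := Q.hbarIncl
  have hi : ∀ x, i x = (X : ℂ[X]) • Q.incl x := fun _ => rfl
  have hiinj : Function.Injective i := Q.hbarIncl_injective
  obtain ⟨l, hl⟩ := i.exists_leftInverse_of_injective (LinearMap.ker_eq_bot.2 hiinj)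
  let φ : 𝔤 →ₗ[ℂ] 𝔤 := l ∘ₗ (Q.comp 1).subtype ∘ₗ (J - J')
  have hφ : ∀ x, (J x : H) - (J' x : H) = i (φ x) := fun x => by
    have hc := (Q.hasYangianComul_iff _ _).2 (hJ.comul_apply x)
    have hc' := (Q.hasYangianComul_iff _ _).2 (hJ'.comul_apply x)
    obtain ⟨z, hz⟩ := Q.exists_eq_hbar_smul_incl (sub_mem (J x).2 (J' x).2)
      (by rw [map_sub, hJ.π_apply, hJ'.π_apply, sub_self]) (by simpa using hc.sub hc')
    have h1 : φ x = z := by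
      change l ((J x : H) - (J' x : H)) = z
      rw [hz, ← hi]
      exact LinearMap.congr_fun hl z
    rw [h1, hz, hi]
  obtain ⟨c, hc⟩ := exists_eq_smul_of_map_lie φ (fun x y => by
    apply hiinj
    rw [← hφ, hJ.map_lie, hJ'.map_lie]
    have h1 : i ⁅x, φ y⁆ = Q.incl x * i (φ y) - i (φ y) * Q.incl x := by
      rw [hi, hi, incl_lie, mul_smul_comm, smul_mul_assoc, smul_sub]
    rw [h1, ← hφ]
    noncomm_ring)
  refine ⟨c, fun x => ?_⟩
  rw [hφ, hc, hi, map_smul, C_mul_X_smul]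

end HomogeneousQuantization
end YangianQuantization

end

open YangianQuantization in
theorem theorem3p3 {𝔤 : Type*} [LieRing 𝔤] [LieAlgebra ℂ 𝔤] [FiniteDimensional ℂ 𝔤]
    [LieAlgebra.IsSimple ℂ 𝔤] (B : LinearMap.BilinForm ℂ 𝔤) (hB : B.Nondegenerate)
    (hsymm : B.IsSymm) (hinv : B.lieInvariant 𝔤)
    {H : Type*} [Ring H] [Algebra ℂ H] [HopfAlgebra ℂ[X] H] [IsScalarTower ℂ ℂ[X] H]
    (Q : HomogeneousQuantization H B hB) :
    (∃ J : 𝔤 →ₗ[ℂ] Q.comp 1, Q.IsDegreeOneLift J) ∧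
      ∀ J J' : 𝔤 →ₗ[ℂ] Q.comp 1, Q.IsDegreeOneLift J → Q.IsDegreeOneLift J' →
        ∃ c : ℂ, ∀ x : 𝔤, (J x : H) - (J' x : H) = (C c * X : ℂ[X]) • Q.incl x :=
  ⟨Q.exists_isDegreeOneLift hsymm hinv, fun _ _ hJ hJ' => Q.exists_sub_eq_smul hJ hJ'⟩
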